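/- **Theorem 2.17.** Let $R'=\mathbb Z[X,Y,Z,U,V,W]/(XU+YV+ZW)$, where $X,Y,Z,U,V,W$ are independent indeterminates over $\mathbb Z$, graded so that $X,Y,Z$ have degree $0$ and $U,V,W$ have degree $1$. Its component of degree $0$ is $R'_0=\mathbb Z[X,Y,Z]$, and its irrelevant ideal $R'_+=\bigoplus_{n>0}R'_n$ is generated by (the images of) $U,V,W$. For $n\in\mathbb Z$ let $H^3_{R'_+}(R')_n$ denote the $n$-th graded component of the third graded local cohomology module of $R'$ with respect to $R'_+$. For a positive integer $n$ let $\Pi(n)$ be the set of all prime numbers that divide $\binom{n}{i}$ for some $i\in\{0,\dots,n\}$. Then the following hold. 1. For every integer $d\ge 3$ and every prime number $p$, $p\mathbb Z\in\operatorname{Ass}_{\mathbb Z}\bigl(H^3_{R'_+}(R')_{-d}\bigr)$ if and only if $p\in\Pi(d-2)$. 2. For every integer $d\ge 3$, $$\operatorname{Ass}_{R'_0}\bigl(H^3_{R'_+}(R')_{-d}\bigr)=\{(X,Y,Z)\}\cup\{(q,X,Y,Z): q\in\Pi(d-2)\}.$$ 3. For every integer $j\ge 3$ the set $\operatorname{Ass}_{R'_0}\bigl(H^3_{R'_+}(R')_{-j}\bigr)$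 is finite, and the set of integers $\bigl\{\#\operatorname{Ass}_{R'_0}\bigl(H^3_{R'_+}(R')_{-j}\bigr): j\ge 3\bigr\}$ is unbounded. 4. For every prime number $p$, the sets $$\bigl\{j\in\mathbb Z: j\ge 3,\ (p,X,Y,Z)\in\operatorname{Ass}_{R'_0}\bigl(H^3_{R'_+}(R')_{-j}\bigr)\bigr\}\quad\text{and}\quad\bigl\{j\in\mathbb Z: j\ge 3,\ (p,X,Y,Z)\notin\operatorname{Ass}_{R'_0}\bigl(H^3_{R'_+}(R')_{-j}\bigr)\bigr\}$$ are both infinite. 5. $\operatorname{Ass}_{R'_0}\bigl(H^3_{R'_+}(R')_n\bigr)$ is not asymptotically increasing for $n\to-\infty$: there is no $n_0\in\mathbb Z$ such that $\operatorname{Ass}_{R'_0}\bigl(H^3_{R'_+}(R')_n\bigr)\subseteq\operatorname{Ass}_{R'_0}\bigl(H^3_{R'_+}(R')_{n-1}\bigr)$ for all $n\le n_0$. -/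

import Mathlib

open MvPolynomial

noncomputable section

/-! ### Graded local cohomology through the Čech complex

For a commutative Noetherian ring `A` and elements `f i` (`i` in a finite, linearly ordered index
set), the local cohomology modules of `A` with respect to the ideal generated by the `f i` are the
cohomology modules of the Čech complex
`0 ⟶ A ⟶ ∏ A_{f i} ⟶ ∏ A_{f i * f j} ⟶ ⋯`. If `A` is graded and the `f i` are homogeneous, then each
term of the complex is graded (degree of `a / s` = degree of `a` minus degree of `s`), the
differentials preserve degrees, and the induced grading is the standard grading on local
cohomology. -/

namespace CechLocal

variable {A ι : Type} [CommRing A]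

/-- The term `C^p` of the Čech complex: the product, over the `p`-element sets `s` of indices, of
the localizations of `A` at `∏ i ∈ s, f i`. -/
abbrev Cochain (f : ι → A) (p : ℕ) : Type :=
  (s : {s : Finset ι // s.card = p}) → Localization.Away (∏ i ∈ s.1, f i)

/-- The canonical map `A_{f_t} → A_{f_s}` for `t ⊆ s`, where `f_s = ∏ i ∈ s, f i`. -/
def res (f : ι → A) {t s : Finset ι} (h : t ⊆ s) :
    Localization.Away (∏ i ∈ t, f i) →ₐ[A] Localization.Away (∏ i ∈ s, f i) :=
  IsLocalization.liftAlgHom (M := Submonoid.powers (∏ i ∈ t, f i))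
    (f := Algebra.ofId A (Localization.Away (∏ i ∈ s, f i))) (by
      rintro ⟨_, n, rfl⟩
      have hs : IsUnit (algebraMap A (Localization.Away (∏ i ∈ s, f i)) (∏ i ∈ s, f i)) :=
        IsLocalization.Away.algebraMap_isUnit _
      have ht : IsUnit (algebraMap A (Localization.Away (∏ i ∈ s, f i)) (∏ i ∈ t, f i)) :=
        isUnit_of_dvd_unit (map_dvd _ (Finset.prod_dvd_prod_of_subset t s f h)) hs
      simpa [Algebra.ofId_apply] using ht.pow n)

theorem res_res (f : ι → A) {t s r : Finset ι} (h : t ⊆ s) (h' : s ⊆ r)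
    (x : Localization.Away (∏ i ∈ t, f i)) :
    res f h' (res f h x) = res f (h.trans h') x := by
  have : (res f h').comp (res f h) = res f (h.trans h') :=
    IsLocalization.algHom_ext (Submonoid.powers (∏ i ∈ t, f i)) (Subsingleton.elim _ _)
  exact congrArg (fun g => g x) this

variable [LinearOrder ι]

/-- The Čech differential `C^p → C^(p+1)`,
`(d c)_s = ∑_{j ∈ s} (-1)^(number of i ∈ s with i < j) • c_{s \ {j}}`. -/
def d (f : ι → A) (p : ℕ) : Cochain f p →ₗ[A] Cochain f (p + 1) :=
  LinearMap.pi fun s =>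
    ∑ j : {j // j ∈ s.1}, (-1 : A) ^ (s.1.filter (· < j.1)).card •
      ((res f (Finset.erase_subset j.1 s.1)).toLinearMap ∘ₗ
        LinearMap.proj (R := A)
          (φ := fun t : {t : Finset ι // t.card = p} => Localization.Away (∏ i ∈ t.1, f i))
          ⟨s.1.erase j.1, by rw [Finset.card_erase_of_mem j.2, s.2]; rfl⟩)

theorem d_apply (f : ι → A) (p : ℕ) (c : Cochain f p) (s : {s : Finset ι // s.card = p + 1}) :
    d f p c s = ∑ j : {j // j ∈ s.1}, (-1 : A) ^ (s.1.filter (· < j.1)).card •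
      res f (Finset.erase_subset j.1 s.1)
        (c ⟨s.1.erase j.1, by rw [Finset.card_erase_of_mem j.2, s.2]; rfl⟩) := by
  simp [d]

open Classical in
/-- The Čech cochains form a complex. -/
theorem d_comp_d (f : ι → A) (p : ℕ) (c : Cochain f p) : d f (p+1) (d f p c) = 0 := by
  funext s
  let G : Finset ι → Localization.Away (∏ i ∈ s.1, f i) := fun t =>
    if h : t ⊆ s.1 ∧ t.card = p then res f h.1 (c ⟨t, h.2⟩) else 0
  have e : d f (p+1) (d f p c) s = ∑ j ∈ s.1, ∑ k ∈ s.1.erase j,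
      ((-1 : A) ^ (s.1.filter (· < j)).card * (-1) ^ ((s.1.erase j).filter (· < k)).card) •
        G ((s.1.erase j).erase k) := by
    rw [d_apply, ← Finset.sum_coe_sort s.1]
    refine Finset.sum_congr rfl fun j _ => ?_
    rw [d_apply, ← Finset.sum_coe_sort (s.1.erase j.1), map_sum, Finset.smul_sum]
    refine Finset.sum_congr rfl fun k _ => ?_
    rw [map_smul, smul_smul, res_res]
    congr 1
    have h : ((s.1.erase j.1).erase k.1) ⊆ s.1 ∧ ((s.1.erase j.1).erase k.1).card = p :=
      ⟨(Finset.erase_subset _ _).trans (Finset.erase_subset _ _), by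
        rw [Finset.card_erase_of_mem k.2, Finset.card_erase_of_mem j.2, s.2]; rfl⟩
    simp only [G, dif_pos h]
  rw [e, Finset.sum_sigma']
  refine Finset.sum_involution (fun x _ => ⟨x.2, x.1⟩) ?_ ?_ ?_ ?_
  · rintro ⟨j, k⟩ h
    simp only [Finset.mem_sigma, Finset.mem_erase] at h
    obtain ⟨hj, hkj, hk⟩ := h
    dsimp only
    rw [Finset.erase_right_comm, ← add_smul]
    have key : ∀ a b : ι, a ∈ s.1 → b ∈ s.1 → a < b →
      ((-1 : A) ^ (s.1.filter (· < a)).card * (-1) ^ ((s.1.erase a).filter (· < b)).card) +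
      ((-1 : A) ^ (s.1.filter (· < b)).card * (-1) ^ ((s.1.erase b).filter (· < a)).card) = 0 := by
      intro a b ha hb hab
      have h1 : (s.1.erase b).filter (· < a) = s.1.filter (· < a) := by
        ext x; simp only [Finset.mem_filter, Finset.mem_erase]
        constructor
        · rintro ⟨⟨_, h⟩, h2⟩; exact ⟨h, h2⟩
        · rintro ⟨h, h2⟩; exact ⟨⟨(h2.trans hab).ne, h⟩, h2⟩
      have h2 : (s.1.filter (· < b)).card = ((s.1.erase a).filter (· < b)).card + 1 := by
        rw [Finset.filter_erase, Finset.card_erase_add_one]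
        simp [ha, hab]
      rw [h1, h2]; ring
    rcases lt_or_gt_of_ne hkj with h | h
    · have := key k j hk hj h
      rw [← zero_smul A (G ((s.1.erase k).erase j)), ← this]
      congr 1; ring
    · rw [key j k hj hk h, zero_smul]
  · rintro ⟨j, k⟩ h _ heq
    simp only [Finset.mem_sigma, Finset.mem_erase] at h
    exact h.2.1 (congrArg Sigma.fst heq)
  · rintro ⟨j, k⟩ h
    simp only [Finset.mem_sigma, Finset.mem_erase] at h ⊢
    exact ⟨h.2.2, fun h' => h.2.1 h'.symm, h.1⟩
  · rintro ⟨j, k⟩ h; rfl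
/-- The coboundaries in `C^p`: the image of the previous differential, and `0` for `p = 0`. -/
def coboundaries (f : ι → A) : (p : ℕ) → Submodule A (Cochain f p)
  | 0 => ⊥
  | p + 1 => LinearMap.range (d f p)

/-- The `p`-th local cohomology module `H^p` of `A` with respect to the ideal generated by the
`f i`: cocycles of the Čech complex modulo coboundaries. -/
abbrev H (f : ι → A) (p : ℕ) : Type :=
  LinearMap.ker (d f p) ⧸ (coboundaries f p).submoduleOf (LinearMap.ker (d f p))

variable {K : Type} [CommRing K] [Algebra K A]

/-- The component of degree `n` of a localization `S⁻¹A` of an `ℕ`-graded ring `A = ⨁ 𝒜 i`: the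
span of the fractions `a / s` where `a` and `s ∈ S` are homogeneous with
`deg a - deg s = n`. -/
def locDegree (𝒜 : ℕ → Submodule K A) (S : Submonoid A) (n : ℤ) : Submodule K (Localization S) :=
  Submodule.span K {x | ∃ (i j : ℕ) (a : A) (s : S),
    a ∈ 𝒜 i ∧ (s : A) ∈ 𝒜 j ∧ (i : ℤ) - (j : ℤ) = n ∧ x = Localization.mk a s}

/-- The component of degree `n` of the term `C^p` of the Čech complex. -/
def cochainDegree (𝒜 : ℕ → Submodule K A) (f : ι → A) (p : ℕ) (n : ℤ) :
    Submodule K (Cochain f p) :=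
  Submodule.pi Set.univ fun s => locDegree 𝒜 (Submonoid.powers (∏ i ∈ s.1, f i)) n

/-- The component of degree `n` of `H^p`: the classes of the cocycles of degree `n`. -/
def gradedPiece (𝒜 : ℕ → Submodule K A) (f : ι → A) (p : ℕ) (n : ℤ) : Submodule K (H f p) :=
  ((cochainDegree 𝒜 f p n).comap ((LinearMap.ker (d f p)).subtype.restrictScalars K)).map
    (((coboundaries f p).submoduleOf (LinearMap.ker (d f p))).mkQ.restrictScalars K)

end CechLocal

/-! ### Singh's ring -/

namespace Singh

/-- The ring `R₀ = ℤ[X, Y, Z]`; its indeterminates are `X 0`, `X 1`, `X 2`. -/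
abbrev R₀ : Type := MvPolynomial (Fin 3) ℤ

/-- The ring `R = ℤ[X, Y, Z, U, V, W] = R₀[U, V, W]`; the indeterminates `U`, `V`, `W` are
`X 0`, `X 1`, `X 2`. It is graded by the total degree in `U`, `V`, `W`. -/
abbrev R : Type := MvPolynomial (Fin 3) R₀

/-- The polynomial `F = XU + YV + ZW`. -/
def F : R := C (X 0) * X 0 + C (X 1) * X 1 + C (X 2) * X 2

/-- Singh's ring `R' = ℤ[X, Y, Z, U, V, W] / (XU + YV + ZW)`. -/
abbrev R' : Type := R ⧸ Ideal.span {F}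

/-- The component `R'_n` of degree `n`: the image of the forms of degree `n` in `U`, `V`, `W`. -/
def grading (n : ℕ) : Submodule R₀ R' :=
  (homogeneousSubmodule (Fin 3) R₀ n).map (Ideal.Quotient.mkₐ R₀ (Ideal.span {F})).toLinearMap

/-- The images of `U`, `V`, `W` in `R'`. -/
def uvw (i : Fin 3) : R' := Ideal.Quotient.mk (Ideal.span {F}) (X i)

/-- The irrelevant ideal `R'_+`, generated by the components of positive degree. -/
def irrelevant : Ideal R' := Ideal.span {x | ∃ n, 0 < n ∧ x ∈ grading n}

/-- `R'_+` is the ideal generated by the images of `U`, `V`, `W`. -/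
theorem irrelevant_eq : irrelevant = Ideal.span (Set.range uvw) := by
  apply le_antisymm
  · refine Ideal.span_le.2 ?_
    rintro _ ⟨n, hn, q, hq, rfl⟩
    have hq' : q.IsHomogeneous n := hq
    have key : q ∈ Ideal.span (Set.range (X : Fin 3 → R)) := by
      rw [← Set.image_univ, mem_ideal_span_X_image]
      intro m hm
      have hdeg := hq' (mem_support_iff.1 hm)
      by_contra! hcon
      have : m = 0 := by
        ext i
        simpa using hcon i (Set.mem_univ i)
      subst this
      simp at hdeg
      omega
    have := Ideal.mem_map_of_mem (Ideal.Quotient.mk (Ideal.span {F})) key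
    rw [Ideal.map_span, ← Set.range_comp] at this
    exact this
  · refine Ideal.span_le.2 ?_
    rintro _ ⟨i, rfl⟩
    exact Ideal.subset_span ⟨1, one_pos, X i, isHomogeneous_X R₀ i, rfl⟩

/-- `R₀ → R'` is injective ... -/
theorem algebraMap_injective : Function.Injective (algebraMap R₀ R') := by
  let e : R' →+* R₀ := Ideal.Quotient.lift (Ideal.span {F}) (constantCoeff (R := R₀))
    (fun a ha => by
      obtain ⟨b, rfl⟩ := Ideal.mem_span_singleton'.1 ha
      simp [F])
  refine Function.LeftInverse.injective (g := e) fun r => ?_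
  change constantCoeff (C r : R) = r
  simp

/-- ... with image the component `R'_0`; thus `R'_0` is identified with `ℤ[X, Y, Z]`. -/
theorem grading_zero : (grading 0 : Set R') = Set.range (algebraMap R₀ R') := by
  ext x
  constructor
  · rintro ⟨q, hq, rfl⟩
    have hq' : q.IsHomogeneous 0 := hq
    obtain ⟨r, rfl⟩ : ∃ r, q = C r := ⟨_, (totalDegree_eq_zero_iff_eq_C).1 (by
      simpa using hq'.totalDegree_le)⟩
    exact ⟨r, rfl⟩
  · rintro ⟨r, rfl⟩
    exact ⟨C r, isHomogeneous_C _ r, rfl⟩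

/-- The `R₀`-module `H^3_{R'_+}(R')_n`. -/
abbrev H3 (n : ℤ) : Submodule R₀ (CechLocal.H uvw 3) := CechLocal.gradedPiece grading uvw 3 n

/-- The ideal `(X, Y, Z)` of `ℤ[X, Y, Z]`. -/
def idealXYZ : Ideal R₀ := Ideal.span {X 0, X 1, X 2}

/-- The ideal `(q, X, Y, Z)` of `ℤ[X, Y, Z]`. -/
def idealPXYZ (q : ℕ) : Ideal R₀ := Ideal.span {(q : R₀), X 0, X 1, X 2}

end Singh

/-- The set `Π(n)` of the prime factors of the binomial coefficients `C(n, i)`, `0 ≤ i ≤ n`. -/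
def binomialPrimes (n : ℕ) : Set ℕ := {p | p.Prime ∧ ∃ i ≤ n, p ∣ n.choose i}

/-- A family of sets indexed by `ℤ` is asymptotically increasing for `n → -∞` if there is `n₀`
with `S n ⊆ S (n - 1)` for all `n ≤ n₀`. -/
def AsymptoticallyIncreasing {α : Type} (S : ℤ → Set α) : Prop :=
  ∃ n₀ : ℤ, ∀ n ≤ n₀, S n ⊆ S (n - 1)

end

/-! The top Čech cohomology is spanned by inverse monomials `U^(-a-1) V^(-b-1) W^(-c-1)`, and in
degree `-(n+3)` it is the cokernel of multiplication by `F`, viewed as the map `contract` from forms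
of degree `n + 1` to forms of degree `n` over `ℤ[X,Y,Z]` (`inverseClass_eq_zero_iff`,
`gradedPiece_eq_map`). Powers of `X`, `Y`, `Z` kill every element of this cokernel, so its
associated primes contain `(X,Y,Z)` and come from primes of `ℤ`: the zero ideal always contributes,
and `q` contributes exactly when there is `q`-torsion (`associatedPrimes_eq`).

The torsion is combinatorial. In a fixed multidegree `μ` the map sends an integer function `g` on
the lattice points of degree `N = n + 1` in the box `[0, μ]` to the sums `g(i+1,j,k) + g(i,j+1,k) +
g(i,j,k+1)`. A kernel element is determined by its edge `u_i = g(i, N-i, 0)`. With `h(s) = ∑ C(N,i)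
u_i s^i`, vanishing outside the box becomes a degree bound on `h` together with divisibility by
powers of `s` and of `s - 1`, provided no `C(N,i)` vanishes in the coefficients.

If `q` divides no `C(N,i)`, such an `h` lifts from `ℤ/q` to `ℤ`; kernel elements modulo `q` then
lift up to a factor prime to `q`, which excludes `q`-torsion (`mem_range_contract_of_prime_smul`).
If `q ∣ C(N,a)`, the solution with edge supported at `a` takes the value `±C(N,a)` at the corner
`(0,0,N)`; a box omitting that corner gives a torsion class
(`exists_prime_smul_mem_range_contract`).

The remaining claims use `C(n,1) = n` and the fact that `p` divides no `C(p^k - 1, i)`. -/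

noncomputable section

/-! ### Solutions of the trinomial relation -/

namespace Trinomial

variable {A : Type*} [CommRing A]

/-- The sum `∑ C(k, l) u_{i + l}`, over `l ≤ k`. -/
def shiftSum (u : ℕ → A) (i k : ℕ) : A := ∑ l ∈ Finset.range (k + 1), (k.choose l : A) * u (i + l)

theorem shiftSum_zero (u : ℕ → A) (i : ℕ) : shiftSum u i 0 = u i := by simp [shiftSum]

theorem shiftSum_succ (u : ℕ → A) (i k : ℕ) :
    shiftSum u i (k + 1) = shiftSum u i k + shiftSum u (i + 1) k := by
  unfold shiftSum
  have h : ∑ l ∈ Finset.range (k + 1), (k.choose l : A) * u (i + l) =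
      ∑ l ∈ Finset.range (k + 1), (k.choose (l + 1) : A) * u (i + (l + 1)) + u i := by
    have := Finset.sum_range_succ' (fun l => (k.choose l : A) * u (i + l)) (k + 1)
    rw [Finset.sum_range_succ] at this
    simpa using this
  rw [Finset.sum_range_succ', h, add_right_comm, ← Finset.sum_add_distrib]
  simp only [Nat.choose_zero_right, Nat.cast_one, one_mul, add_zero, add_left_inj]
  refine Finset.sum_congr rfl fun l _ => ?_
  rw [Nat.choose_succ_succ, add_assoc i 1 l, add_comm 1 l]
  push_cast
  ring

/-- `g` satisfies the trinomial relation in degree `N`. -/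
def Rel (N : ℕ) (g : ℕ → ℕ → ℕ → A) : Prop :=
  ∀ i j k, i + j + k + 1 = N → g (i + 1) j k + g i (j + 1) k + g i j (k + 1) = 0

/-- `g` vanishes in degree `N` outside the box with sides `α`, `β`, `γ`. -/
def Vanishes (N α β γ : ℕ) (g : ℕ → ℕ → ℕ → A) : Prop :=
  ∀ i j k, i + j + k = N → α < i ∨ β < j ∨ γ < k → g i j k = 0

/-- The relation expresses layer `k + 1` through layer `k`, so a solution is determined by its edge
`k = 0`; iterating produces the binomial weights by Pascal's rule. -/
theorem Rel.eq_shiftSum {N : ℕ} {g : ℕ → ℕ → ℕ → A} (hg : Rel N g) (k : ℕ) :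
    ∀ i j, i + j + k = N → g i j k = (-1) ^ k * shiftSum (fun i => g i (N - i) 0) i k := by
  induction k with
  | zero =>
    intro i j h
    obtain rfl : j = N - i := by omega
    simp [shiftSum_zero]
  | succ k ih =>
    intro i j h
    have h1 := hg i j k (by omega)
    rw [ih (i + 1) j (by omega), ih i (j + 1) (by omega)] at h1
    rw [shiftSum_succ, pow_succ]
    linear_combination h1

theorem rel_shiftSum (N : ℕ) (u : ℕ → A) : Rel N fun i _ k => (-1) ^ k * shiftSum u i k := by
  intro i j k _
  simp only [shiftSum_succ, pow_succ]
  ring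

/-- The polynomial `∑ C(N, i) u_i s^i`. -/
def binomialPoly (N : ℕ) (u : ℕ → A) : Polynomial A :=
  ∑ i ∈ Finset.range (N + 1), Polynomial.monomial i ((N.choose i : A) * u i)

theorem coeff_binomialPoly (N : ℕ) (u : ℕ → A) (i : ℕ) :
    (binomialPoly N u).coeff i = (N.choose i : A) * u i := by
  simp only [binomialPoly, Polynomial.finsetSum_coeff, Polynomial.coeff_monomial,
    Finset.sum_ite_eq', Finset.mem_range]
  split_ifs with h
  · rfl
  · rw [Nat.choose_eq_zero_of_lt (by omega)]; simp

/-- This is why the weights `C(N, i)` are inserted: by `C(N, j+l) C(j+l, j) = C(N, j) C(N-j, l)`,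
expanding at `1` turns the edge `k = 0` into the edge where the second coordinate is `0`. -/
theorem coeff_taylor_binomialPoly {N : ℕ} (u : ℕ → A) {j : ℕ} (hj : j ≤ N) :
    (Polynomial.taylor 1 (binomialPoly N u)).coeff j =
      (N.choose j : A) * shiftSum u j (N - j) := by
  rw [Polynomial.taylor_coeff, binomialPoly, map_sum, Polynomial.eval_finsetSum]
  simp only [Polynomial.hasseDeriv_monomial, Polynomial.eval_monomial, one_pow, mul_one]
  obtain ⟨k, rfl⟩ := Nat.exists_eq_add_of_le hj
  rw [add_assoc, Finset.sum_range_add, Finset.sum_eq_zero, zero_add, shiftSum, Finset.mul_sum,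
    Nat.add_sub_cancel_left]
  · refine Finset.sum_congr rfl fun l hl => ?_
    have := Nat.choose_mul (n := j + k) (k := j + l) (s := j)
      (by omega)
    simp only [Nat.add_sub_cancel_left] at this
    rw [← mul_assoc, ← mul_assoc, ← Nat.cast_mul, ← Nat.cast_mul, mul_comm ((j + l).choose j), this]
  · intro i hi
    rw [Nat.choose_eq_zero_of_lt (Finset.mem_range.1 hi)]; simp

theorem X_sub_one_pow_dvd_iff (c : ℕ) (h : Polynomial A) :
    (Polynomial.X - 1) ^ c ∣ h ↔ ∀ j < c, (Polynomial.taylor 1 h).coeff j = 0 := by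
  rw [← Polynomial.X_pow_dvd_iff]
  have e : Polynomial.taylorEquiv (1 : A) ((Polynomial.X - 1) ^ c) = Polynomial.X ^ c := by
    simp [Polynomial.taylorEquiv]
  rw [← map_dvd_iff (Polynomial.taylorEquiv (1 : A)), e]
  rfl

/-- The bounds `α` and `β` hold because `shiftSum u i k` only involves `u_i, …, u_{i+k}`. For `γ`,
divisibility by a power of `X - 1` gives vanishing on the edge `j = 0`, and the relation carries it
inwards by induction on `j`. -/
theorem vanishes_shiftSum [IsDomain A] {N : ℕ} (hN : ∀ i ≤ N, (N.choose i : A) ≠ 0) {u : ℕ → A}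
    {α β γ : ℕ} (h1 : ∀ i ≤ N, α < i → u i = 0) (h2 : ∀ i ≤ N, i < N - β → u i = 0)
    (h3 : (Polynomial.X - 1) ^ (N - γ) ∣ binomialPoly N u) :
    Vanishes N α β γ fun i _ k => (-1) ^ k * shiftSum u i k := by
  have key : ∀ j i k, i + j + k = N → γ < k → shiftSum u i k = 0 := by
    intro j
    induction j with
    | zero =>
      intro i k h hk
      have := (X_sub_one_pow_dvd_iff _ _).1 h3 i (by omega)
      rw [coeff_taylor_binomialPoly u (by omega)] at this
      obtain rfl : k = N - i := by omega
      exact (mul_eq_zero.1 this).resolve_left (hN i (by omega))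
    | succ j ih =>
      intro i k h hk
      have h4 := shiftSum_succ u i k
      rw [ih i (k + 1) (by omega) (by omega), ih (i + 1) k (by omega) hk] at h4
      simpa using h4.symm
  rintro i j k h (hi | hj | hk)
  · dsimp only
    rw [shiftSum, Finset.sum_eq_zero, mul_zero]
    intro l hl
    have := Finset.mem_range.1 hl
    rw [h1 _ (by omega) (by omega), mul_zero]
  · dsimp only
    rw [shiftSum, Finset.sum_eq_zero, mul_zero]
    intro l hl
    have := Finset.mem_range.1 hl
    rw [h2 _ (by omega) (by omega), mul_zero]
  · dsimp only
    rw [key j i k h hk, mul_zero]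

open scoped Polynomial in
/-- If no binomial coefficient `C(N, i)` vanishes modulo `q`, then the solutions modulo `q` of the
trinomial relation that are supported in a box lift to integral solutions supported in the box, up
to the factor `∏ C(N, i)`. -/
theorem exists_lift (q : ℕ) [Fact q.Prime] {N : ℕ} (hN : ∀ i ≤ N, ¬ q ∣ N.choose i) {α β γ : ℕ}
    {g : ℕ → ℕ → ℕ → ZMod q} (hg : Rel N g) (hv : Vanishes N α β γ g) :
    ∃ g' : ℕ → ℕ → ℕ → ℤ, Rel N g' ∧ Vanishes N α β γ g' ∧ ∀ i j k, i + j + k = N →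
      (g' i j k : ZMod q) = (∏ i ∈ Finset.range (N + 1), N.choose i : ℕ) * g i j k := by
  have hN' : ∀ i ≤ N, (N.choose i : ZMod q) ≠ 0 := fun i hi h =>
    hN i hi ((ZMod.natCast_eq_zero_iff _ _).1 h)
  set u : ℕ → ZMod q := fun i => g i (N - i) 0 with hu
  have d1 : (Polynomial.X : (ZMod q)[X]) ^ (N - β) ∣ binomialPoly N u := by
    rw [Polynomial.X_pow_dvd_iff]
    intro i hi
    rw [coeff_binomialPoly, hu]
    dsimp only
    rw [hv _ _ _ (by omega) (by omega), mul_zero]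
  have d2 : (Polynomial.X - 1 : (ZMod q)[X]) ^ (N - γ) ∣ binomialPoly N u := by
    rw [X_sub_one_pow_dvd_iff]
    intro i hi
    rw [coeff_taylor_binomialPoly u (by omega)]
    have h1 := hg.eq_shiftSum (N - i) i 0 (by omega)
    rw [hv _ _ _ (by omega) (by omega)] at h1
    have h2 := (mul_eq_zero.1 h1.symm).resolve_left (pow_ne_zero _ (neg_ne_zero.2 one_ne_zero))
    rw [h2, mul_zero]
  have hcop : IsCoprime (Polynomial.X : (ZMod q)[X]) (Polynomial.X - 1) := ⟨1, -1, by ring⟩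
  obtain ⟨p, hp⟩ := (hcop.pow (m := N - β) (n := N - γ)).mul_dvd d1 d2
  -- Only the cofactor is lifted, and without raising its degree: the two divisibilities and the
  -- bounds by `α` and `N` all survive over `ℤ`.
  obtain ⟨P, hP, hPd⟩ := Polynomial.exists_degree_eq_of_mem_lifts
    (f := Int.castRingHom (ZMod q)) (p := p)
    ((Polynomial.mem_lifts _).2 (Polynomial.map_surjective _ (ZMod.ringHom_surjective _) p))
  set H : ℤ[X] := Polynomial.X ^ (N - β) * (Polynomial.X - 1) ^ (N - γ) * P with hH
  have hmap : H.map (Int.castRingHom (ZMod q)) = binomialPoly N u := by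
    rw [hp, hH]; simp [hP]
  have hdeg : H.degree = (binomialPoly N u).degree := by
    rw [hp, hH]
    simp only [Polynomial.degree_mul, Polynomial.degree_pow, Polynomial.degree_X, hPd]
    rw [← Polynomial.C_1, ← Polynomial.C_1, Polynomial.degree_X_sub_C, Polynomial.degree_X_sub_C]
  have hcoef : ∀ i, N < i ∨ α < i → H.coeff i = 0 := by
    intro i hi
    apply Polynomial.coeff_eq_zero_of_degree_lt
    rw [hdeg, Polynomial.degree_lt_iff_coeff_zero]
    intro m hm
    rw [coeff_binomialPoly]
    rcases Nat.lt_or_ge N m with h | h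
    · rw [Nat.choose_eq_zero_of_lt h]; simp
    · rw [hu]
      dsimp only
      rw [hv _ _ _ (by omega) (by omega), mul_zero]
  -- Recovering the edge from `H` requires division by `C(N, i)`, impossible over `ℤ` in general;
  -- the factor `r` makes it exact.
  set r : ℕ := ∏ i ∈ Finset.range (N + 1), N.choose i with hr
  have hrd : ∀ i ≤ N, N.choose i ∣ r := fun i hi =>
    Finset.dvd_prod_of_mem _ (Finset.mem_range.2 (by omega))
  set U : ℕ → ℤ := fun i => (r / N.choose i : ℕ) * H.coeff i with hU
  have hUH : ∀ i ≤ N, (N.choose i : ℤ) * U i = r * H.coeff i := by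
    intro i hi
    rw [hU]
    dsimp only
    rw [← mul_assoc, ← Nat.cast_mul, Nat.mul_div_cancel' (hrd i hi)]
  have hbin : binomialPoly N U = Polynomial.C (r : ℤ) * H := by
    ext i
    rw [coeff_binomialPoly, Polynomial.coeff_C_mul]
    rcases Nat.lt_or_ge N i with h | h
    · rw [hcoef i (Or.inl h), Nat.choose_eq_zero_of_lt h]; simp
    · exact hUH i h
  refine ⟨fun i _ k => (-1) ^ k * shiftSum U i k, rel_shiftSum N U, vanishes_shiftSum ?_ ?_ ?_ ?_,
    ?_⟩
  · intro i hi
    exact_mod_cast (Nat.choose_pos hi).ne'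
  · intro i _ hi
    rw [hU]; dsimp only; rw [hcoef i (Or.inr hi), mul_zero]
  · intro i _ hi
    have : H.coeff i = 0 := by
      have : (Polynomial.X : ℤ[X]) ^ (N - β) ∣ H :=
        ⟨(Polynomial.X - 1) ^ (N - γ) * P, by rw [hH]; ring⟩
      exact Polynomial.X_pow_dvd_iff.1 this i hi
    rw [hU]; dsimp only; rw [this, mul_zero]
  · rw [hbin]
    exact ⟨Polynomial.C (r : ℤ) * Polynomial.X ^ (N - β) * P, by rw [hH]; ring⟩
  · intro i j k h
    rw [hg.eq_shiftSum k i j h]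
    have hUu : ∀ i ≤ N, (U i : ZMod q) = r * u i := by
      intro i hi
      refine mul_left_cancel₀ (hN' i hi) ?_
      have h1 := congrArg (Int.cast : ℤ → ZMod q) (hUH i hi)
      have h2 : ((H.coeff i : ℤ) : ZMod q) = (N.choose i : ZMod q) * u i := by
        rw [← coeff_binomialPoly, ← hmap]; simp
      push_cast at h1
      rw [h1, h2]; ring
    simp only [shiftSum]
    push_cast
    rw [Finset.mul_sum, Finset.mul_sum, Finset.mul_sum]
    refine Finset.sum_congr rfl fun l hl => ?_
    have := Finset.mem_range.1 hl
    rw [hUu _ (by omega)]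
    ring

end Trinomial

/-! ### The contraction by `F` on the inverse polynomials -/

namespace Singh

/-- The action of `F = XU + YV + ZW` on inverse polynomials, the inverse monomial
`U^(-a-1) V^(-b-1) W^(-c-1)` being written as the monomial with exponents `a`, `b`, `c`. -/
def contract : R →ₗ[R₀] R where
  toFun g := ∑ i, C (X i) * divMonomial g (Finsupp.single i 1)
  map_add' g h := by simp only [add_divMonomial, mul_add, Finset.sum_add_distrib]
  map_smul' r g := by
    ext e : 1
    simp only [coeff_sum, coeff_C_mul, coeff_divMonomial, coeff_smul, RingHom.id_apply,
      smul_eq_mul, Finset.mul_sum]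
    exact Finset.sum_congr rfl fun i _ => mul_left_comm _ _ _

theorem coeff_contract (g : R) (e : Fin 3 →₀ ℕ) :
    coeff e (contract g) = ∑ i, X i * coeff (e + Finsupp.single i 1) g := by
  simp only [contract, LinearMap.coe_mk, AddHom.coe_mk, coeff_sum, coeff_C_mul, coeff_divMonomial,
    add_comm e]

theorem contract_monomial (e : Fin 3 →₀ ℕ) (c : R₀) :
    contract (monomial e c) =
      ∑ i, if e i = 0 then 0 else monomial (e - Finsupp.single i 1) (X i * c) := by
  ext d : 1
  rw [coeff_contract, coeff_sum]
  refine Finset.sum_congr rfl fun i _ => ?_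
  rw [coeff_monomial]
  split_ifs with h1 h2 h2
  · have := DFunLike.congr_fun h1 i
    simp at this; omega
  · rw [coeff_monomial, if_pos]
    rw [h1, add_tsub_cancel_right]
  · simp
  · rw [coeff_monomial, if_neg, mul_zero]
    rintro rfl
    exact h1 (tsub_add_cancel_of_le (by
      rw [Finsupp.single_le_iff]; omega)).symm

/-- Used to show that integer multiples of a monomial with coefficient `1` stay nonzero in the
cokernel. -/
theorem constantCoeff_coeff_contract (g : R) (e : Fin 3 →₀ ℕ) :
    constantCoeff (coeff e (contract g)) = 0 := by
  simp [coeff_contract]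

/-- Contracting the monomial with exponent `e + single i 1` trades `X i` times the monomial of
exponent `e` for multiples of monomials whose exponents off `i` have total `m - 1`. After `m + 1`
trades nothing remains. -/
theorem X_pow_smul_monomial_mem_range_contract (i : Fin 3) (c : R₀) (m : ℕ) :
    ∀ e : Fin 3 →₀ ℕ, ∑ j ∈ Finset.univ.erase i, e j = m →
      (X i : R₀) ^ (m + 1) • (monomial e c : R) ∈ LinearMap.range contract := by
  induction m with
  | zero =>
    intro e he
    refine ⟨monomial (e + Finsupp.single i 1) c, ?_⟩
    rw [contract_monomial, Finset.sum_eq_single i]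
    · simp [smul_monomial]
    · intro j _ hj
      have : e j = 0 := Finset.sum_eq_zero_iff.1 he j (by simp [hj])
      simp [this, hj.symm]
    · simp
  | succ m ih =>
    intro e he
    have h := contract_monomial (e + Finsupp.single i 1) c
    rw [← Finset.add_sum_erase _ _ (Finset.mem_univ i)] at h
    have h1 : (monomial e (X i * c) : R) = (X i : R₀) • monomial e c := by simp [smul_monomial]
    simp only [Finsupp.coe_add, Pi.add_apply, Finsupp.single_eq_same, Nat.add_eq_zero_iff,
      one_ne_zero, and_false, if_false, add_tsub_cancel_right] at h
    rw [h1, ← sub_eq_iff_eq_add] at h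
    rw [pow_succ, mul_smul, ← h, smul_sub]
    refine Submodule.sub_mem _ (Submodule.smul_mem _ _ ⟨_, rfl⟩) ?_
    rw [Finset.smul_sum]
    refine Submodule.sum_mem _ fun j hj => ?_
    split_ifs with h0
    · simp
    · have hji : j ≠ i := Finset.ne_of_mem_erase hj
      have h2 : ∀ d : Fin 3 →₀ ℕ, (monomial d (X j * c) : R) = (X j : R₀) • monomial d c := by
        intro d; simp [smul_monomial]
      rw [h2, smul_comm]
      refine Submodule.smul_mem _ _ (ih _ ?_)
      have hle : Finsupp.single j 1 ≤ e := by
        rw [Finsupp.single_le_iff]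
        simp [hji.symm] at h0
        omega
      have h3 : e + Finsupp.single i 1 - Finsupp.single j 1 + Finsupp.single j 1 =
          e + Finsupp.single i 1 := tsub_add_cancel_of_le (hle.trans (by simp))
      have h4 : ∑ k ∈ Finset.univ.erase i,
          (e + Finsupp.single i 1 - Finsupp.single j 1 + Finsupp.single j 1 : Fin 3 →₀ ℕ) k =
          ∑ k ∈ Finset.univ.erase i, e k := by
        rw [h3]
        refine Finset.sum_congr rfl fun k hk => ?_
        simp [Finset.ne_of_mem_erase hk]
      have h5 : ∑ k ∈ Finset.univ.erase i, (Finsupp.single j 1 : Fin 3 →₀ ℕ) k = 1 := by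
        rw [Finset.sum_eq_single j]
        · simp
        · intro b _ hb; simp [hb]
        · intro hh; exact absurd hj hh
      simp only [Finsupp.coe_add, Pi.add_apply, Finset.sum_add_distrib] at h4
      rw [h5, he] at h4
      simpa using h4

theorem X_pow_smul_mem_range_contract {n : ℕ} {f : R} (hf : f.IsHomogeneous n) (i : Fin 3) :
    (X i : R₀) ^ (n + 1) • f ∈ LinearMap.range contract := by
  rw [f.as_sum, Finset.smul_sum]
  refine Submodule.sum_mem _ fun e he => ?_
  have hd := hf (mem_support_iff.1 he)
  have hle : ∑ j ∈ Finset.univ.erase i, e j ≤ n := by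
    rw [← hd, Finsupp.weight_apply, Finsupp.sum_fintype _ _ (by simp)]
    simp only [Pi.one_apply, smul_eq_mul, mul_one]
    exact Finset.sum_le_sum_of_subset (Finset.erase_subset _ _)
  obtain ⟨k, rfl⟩ := Nat.exists_eq_add_of_le hle
  rw [add_right_comm, pow_add, mul_comm, mul_smul]
  exact Submodule.smul_mem _ _ (X_pow_smul_monomial_mem_range_contract i _ _ e rfl)

/-! ### The fine grading -/

/-- The component of `f` of multidegree `μ`, as a function of the exponents of the inverse
monomials. -/
def toBox (μ : Fin 3 →₀ ℕ) (f : R) (e : Fin 3 →₀ ℕ) : ℤ :=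
  if e ≤ μ then coeff (μ - e) (coeff e f) else 0

/-- The element of degree `n` and multidegree `μ` with coefficients `G`. -/
def ofBox (μ : Fin 3 →₀ ℕ) (n : ℕ) (G : (Fin 3 →₀ ℕ) → ℤ) : R :=
  ∑ e ∈ (Finset.Iic μ).filter (fun e => e.degree = n), monomial e (monomial (μ - e) (G e))

theorem toBox_of_not_le {μ e : Fin 3 →₀ ℕ} (f : R) (h : ¬ e ≤ μ) : toBox μ f e = 0 := if_neg h

theorem toBox_add (μ e : Fin 3 →₀ ℕ) (f g : R) : toBox μ (f + g) e = toBox μ f e + toBox μ g e := by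
  unfold toBox; split_ifs <;> simp

theorem toBox_zero (μ e : Fin 3 →₀ ℕ) : toBox μ 0 e = 0 := by simp [toBox]

theorem toBox_zsmul (μ e : Fin 3 →₀ ℕ) (z : ℤ) (f : R) : toBox μ (z • f) e = z * toBox μ f e := by
  have h : z • f = C (C z) * f := by rw [zsmul_eq_mul]; simp
  rw [h]
  unfold toBox; split_ifs <;> simp only [coeff_C_mul, mul_zero]

theorem toBox_sum {κ : Type*} (s : Finset κ) (μ e : Fin 3 →₀ ℕ) (f : κ → R) :
    toBox μ (∑ k ∈ s, f k) e = ∑ k ∈ s, toBox μ (f k) e := by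
  unfold toBox; split_ifs <;> simp [coeff_sum]

theorem ext_toBox {f g : R} (h : ∀ μ e, toBox μ f e = toBox μ g e) : f = g := by
  ext e ν
  simpa [toBox] using h (ν + e) e

theorem toBox_ofBox (μ ν : Fin 3 →₀ ℕ) (n : ℕ) (G : (Fin 3 →₀ ℕ) → ℤ) (e : Fin 3 →₀ ℕ) :
    toBox ν (ofBox μ n G) e = if ν = μ ∧ e ≤ μ ∧ e.degree = n then G e else 0 := by
  unfold toBox ofBox
  rw [coeff_sum]
  simp only [coeff_monomial]
  rw [Finset.sum_ite_eq']
  simp only [Finset.mem_filter, Finset.mem_Iic]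
  split_ifs with h1 h2 h3 h3 h3
  · obtain ⟨rfl, -⟩ := h3; simp
  · rw [coeff_monomial, if_neg]
    intro h4
    refine h3 ⟨?_, h2⟩
    rw [← tsub_add_cancel_of_le h1, ← h4, tsub_add_cancel_of_le h2.1]
  · exact absurd h3.2 h2
  · simp
  · exact absurd (h3.1 ▸ h3.2.1) h1
  · rfl

/-- Each term lowers the exponent of one inverse variable and multiplies by the matching variable of
`R₀`, so the sum of both exponent vectors is preserved and the variables `X i` disappear. -/
theorem toBox_contract (μ : Fin 3 →₀ ℕ) (g : R) (e : Fin 3 →₀ ℕ) :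
    toBox μ (contract g) e = ∑ i, toBox μ g (e + Finsupp.single i 1) := by
  unfold toBox
  split_ifs with h
  · rw [coeff_contract, coeff_sum]
    refine Finset.sum_congr rfl fun i _ => ?_
    rw [coeff_X_mul']
    have : i ∈ (μ - e).support ↔ e + Finsupp.single i 1 ≤ μ := by
      rw [Finsupp.mem_support_iff, ← le_tsub_iff_left h, Finsupp.single_le_iff]
      omega
    simp only [this, tsub_tsub]
  · rw [Finset.sum_eq_zero]
    intro i _
    rw [if_neg fun h' => h ((by simp : e ≤ e + Finsupp.single i 1).trans h')]

/-- `ofBox` discards the values of `G` outside the box, so `G` must vanish there for the full sums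
to be correct. -/
theorem contract_ofBox {μ : Fin 3 →₀ ℕ} {n : ℕ} {G : (Fin 3 →₀ ℕ) → ℤ}
    (hG : ∀ e, e.degree = n + 1 → ¬ e ≤ μ → G e = 0) :
    contract (ofBox μ (n + 1) G) = ofBox μ n fun e => ∑ i, G (e + Finsupp.single i 1) := by
  refine ext_toBox fun ν e => ?_
  rw [toBox_contract, toBox_ofBox]
  simp only [toBox_ofBox, map_add, Finsupp.degree_single, Nat.add_right_cancel_iff]
  split_ifs with h
  · refine Finset.sum_congr rfl fun i _ => ?_
    by_cases h' : e + Finsupp.single i 1 ≤ μ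
    · rw [if_pos ⟨h.1, h', h.2.2⟩]
    · rw [if_neg fun h'' => h' h''.2.1, hG _ (by simp [h.2.2]) h']
  · refine Finset.sum_eq_zero fun i _ => if_neg fun h' => h ⟨h'.1, ?_, h'.2.2⟩
    exact (by simp : e ≤ e + Finsupp.single i 1).trans h'.2.1

theorem isHomogeneous_ofBox (μ : Fin 3 →₀ ℕ) (n : ℕ) (G : (Fin 3 →₀ ℕ) → ℤ) :
    (ofBox μ n G).IsHomogeneous n :=
  IsHomogeneous.sum _ _ _ fun _ he => isHomogeneous_monomial _ (Finset.mem_filter.1 he).2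

theorem zsmul_ofBox (μ : Fin 3 →₀ ℕ) (n : ℕ) (z : ℤ) (G : (Fin 3 →₀ ℕ) → ℤ) :
    z • ofBox μ n G = ofBox μ n fun e => z * G e := by
  refine ext_toBox fun ν e => ?_
  simp only [toBox_zsmul, toBox_ofBox, mul_ite, mul_zero]

theorem ofBox_congr {μ : Fin 3 →₀ ℕ} {n : ℕ} {G G' : (Fin 3 →₀ ℕ) → ℤ}
    (h : ∀ e, e.degree = n → G e = G' e) : ofBox μ n G = ofBox μ n G' :=
  Finset.sum_congr rfl fun e he => by rw [h e (Finset.mem_filter.1 he).2]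

theorem exists_eq_sum_ofBox {n : ℕ} {f : R} (hf : f.IsHomogeneous n) :
    ∃ T : Finset (Fin 3 →₀ ℕ), f = ∑ μ ∈ T, ofBox μ n (toBox μ f) := by
  classical
  refine ⟨f.support.biUnion fun e => (coeff e f).support.image (· + e), ext_toBox fun ν e => ?_⟩
  simp only [toBox_sum, toBox_ofBox]
  by_cases h : toBox ν f e = 0
  · rw [h, Finset.sum_eq_zero]
    intro μ _
    split_ifs with h'
    · rw [← h'.1, h]
    · rfl
  · have hle : e ≤ ν := by
      by_contra hle
      exact h (toBox_of_not_le f hle)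
    have hc : coeff (ν - e) (coeff e f) ≠ 0 := by rwa [toBox, if_pos hle] at h
    have he : coeff e f ≠ 0 := by
      intro h0
      exact hc (by rw [h0, coeff_zero])
    have hd : e.degree = n := by
      have := hf he
      rwa [Pi.one_def, ← Finsupp.degree_eq_weight_one] at this
    rw [Finset.sum_eq_single ν]
    · rw [if_pos ⟨rfl, hle, hd⟩]
    · intro μ _ hμ
      rw [if_neg fun h' => hμ h'.1.symm]
    · intro hν
      refine absurd ?_ hν
      simp only [Finset.mem_biUnion, mem_support_iff, Finset.mem_image]
      exact ⟨e, he, ν - e, hc, tsub_add_cancel_of_le hle⟩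

end Singh

/-! ### The torsion of the cokernel of the contraction -/

namespace Singh

/-- The exponent vector `(i, j, k)`. -/
def triple (i j k : ℕ) : Fin 3 →₀ ℕ :=
  Finsupp.single 0 i + Finsupp.single 1 j + Finsupp.single 2 k

@[simp] theorem triple_zero (i j k : ℕ) : triple i j k 0 = i := by simp [triple]

@[simp] theorem triple_one (i j k : ℕ) : triple i j k 1 = j := by simp [triple]

@[simp] theorem triple_two (i j k : ℕ) : triple i j k 2 = k := by simp [triple]

theorem eq_triple (e : Fin 3 →₀ ℕ) : e = triple (e 0) (e 1) (e 2) := by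
  ext i; fin_cases i <;> simp

theorem degree_eq (e : Fin 3 →₀ ℕ) : e.degree = e 0 + e 1 + e 2 := by
  rw [Finsupp.degree_eq_sum, Fin.sum_univ_three]

theorem le_iff (e μ : Fin 3 →₀ ℕ) : e ≤ μ ↔ e 0 ≤ μ 0 ∧ e 1 ≤ μ 1 ∧ e 2 ≤ μ 2 := by
  rw [Finsupp.le_def, Fin.forall_fin_succ, Fin.forall_fin_two]; rfl

theorem sum_add_single {A : Type*} [AddCommMonoid A] (G : (Fin 3 →₀ ℕ) → A) (i j k : ℕ) :
    ∑ l, G (triple i j k + Finsupp.single l 1) =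
      G (triple (i + 1) j k) + G (triple i (j + 1) k) + G (triple i j (k + 1)) := by
  have h : ∀ l, triple i j k + Finsupp.single l 1 =
      ![triple (i + 1) j k, triple i (j + 1) k, triple i j (k + 1)] l := by
    intro l
    ext m
    fin_cases l <;> fin_cases m <;> simp
  rw [Fin.sum_univ_three, h, h, h]
  rfl

open Trinomial in
/-- If the prime `q` divides no binomial coefficient `C(n + 1, i)`, then the cokernel of the
contraction has no `q`-torsion in degree `n`. -/
theorem mem_range_contract_of_prime_smul {q n : ℕ} (hq : q.Prime)
    (hN : ∀ i ≤ n + 1, ¬ q ∣ (n + 1).choose i) {f : R} (hf : f.IsHomogeneous n)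
    (h : (q : ℤ) • f ∈ LinearMap.range contract) : f ∈ LinearMap.range contract := by
  have : Fact q.Prime := ⟨hq⟩
  obtain ⟨g, hg⟩ := h
  set r : ℕ := ∏ i ∈ Finset.range (n + 1 + 1), (n + 1).choose i with hr
  have key : ∀ μ, (r : ℤ) • ofBox μ n (toBox μ f) ∈ LinearMap.range contract := by
    intro μ
    have hκ : ∀ e, ∑ l, toBox μ g (e + Finsupp.single l 1) = q * toBox μ f e := by
      intro e
      rw [← toBox_contract, hg, toBox_zsmul]
    have hrel : Rel (n + 1) fun i j k => (toBox μ g (triple i j k) : ZMod q) := by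
      intro i j k _
      have := congrArg (Int.cast : ℤ → ZMod q) (hκ (triple i j k))
      rw [sum_add_single] at this
      push_cast at this
      rw [this]; simp
    have hvan : Vanishes (n + 1) (μ 0) (μ 1) (μ 2)
        fun i j k => (toBox μ g (triple i j k) : ZMod q) := by
      intro i j k _ hijk
      dsimp only
      rw [toBox_of_not_le, Int.cast_zero]
      rw [le_iff]
      simp only [triple_zero, triple_one, triple_two]
      omega
    obtain ⟨g', hrel', hvan', hcongr⟩ := exists_lift q hN hrel hvan
    -- The lift `g'` agrees with `r g` modulo `q` and contracts to `0`. Hence the quotient is exact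
    -- in degree `n + 1` and contracts to `r f`.
    set G : (Fin 3 →₀ ℕ) → ℤ := fun e => (r * toBox μ g e - g' (e 0) (e 1) (e 2)) / q with hG
    have hGq : ∀ e : Fin 3 →₀ ℕ, e.degree = n + 1 →
        q * G e = r * toBox μ g e - g' (e 0) (e 1) (e 2) := by
      intro e he
      apply Int.mul_ediv_cancel'
      rw [← ZMod.intCast_eq_intCast_iff_dvd_sub, hcongr _ _ _ (by rw [← degree_eq, he]),
        ← eq_triple, Int.cast_mul, Int.cast_natCast]
    have hG0 : ∀ e, e.degree = n + 1 → ¬ e ≤ μ → G e = 0 := by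
      intro e he hle
      rw [hG]
      dsimp only
      rw [toBox_of_not_le _ hle, hvan' _ _ _ (by rw [← degree_eq, he])]
      · simp
      · rw [le_iff] at hle
        omega
    refine ⟨ofBox μ (n + 1) G, ?_⟩
    rw [contract_ofBox hG0, zsmul_ofBox]
    refine ofBox_congr fun e he => ?_
    have hq0 : (q : ℤ) ≠ 0 := by exact_mod_cast hq.ne_zero
    refine mul_left_cancel₀ hq0 ?_
    rw [Finset.mul_sum, mul_left_comm, ← hκ, Finset.mul_sum]
    rw [Finset.sum_congr rfl fun l _ => hGq (e + Finsupp.single l 1) (by simp [he])]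
    rw [Finset.sum_sub_distrib, sub_eq_self]
    rw [eq_triple e, sum_add_single fun d => g' (d 0) (d 1) (d 2)]
    simp only [triple_zero, triple_one, triple_two]
    exact hrel' _ _ _ (by rw [← degree_eq, he])
  have hrf : (r : ℤ) • f ∈ LinearMap.range contract := by
    obtain ⟨T, hT⟩ := exists_eq_sum_ofBox hf
    rw [hT, Finset.smul_sum]
    exact Submodule.sum_mem _ fun μ _ => key μ
  -- Both `r f` and `q f` are in the range, so a Bézout relation puts `f` there.
  have hcop : IsCoprime (r : ℤ) q := by
    rw [Nat.isCoprime_iff_coprime, Nat.coprime_comm, hr]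
    refine Nat.Coprime.prod_right fun i hi => ?_
    exact (hq.coprime_iff_not_dvd).2 (hN i (by simpa [Nat.lt_succ_iff] using hi))
  obtain ⟨a, b, hab⟩ := hcop
  rw [← one_smul ℤ f, ← hab, add_smul, mul_smul, mul_smul]
  have hz : ∀ (z : ℤ) (x : R), x ∈ LinearMap.range contract → z • x ∈ LinearMap.range contract :=
    fun z x hx => (LinearMap.range contract).toAddSubgroup.zsmul_mem hx z
  exact Submodule.add_mem _ (hz _ _ hrf) (hz _ _ ⟨g, hg⟩)

open Trinomial in
/-- If the prime `q` divides the binomial coefficient `C(n + 1, a)`, then the cokernel of the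
contraction has `q`-torsion in degree `n`. -/
theorem exists_prime_smul_mem_range_contract {q n a : ℕ} (hq : q.Prime) (ha : a ≤ n + 1)
    (hqa : q ∣ (n + 1).choose a) :
    ∃ f : R, f.IsHomogeneous n ∧ (q : ℤ) • f ∈ LinearMap.range contract ∧
      f ∉ LinearMap.range contract := by
  have ha0 : a ≠ 0 := by
    rintro rfl
    exact hq.one_lt.ne' (Nat.dvd_one.1 (by simpa using hqa))
  have haN : a ≠ n + 1 := by
    rintro rfl
    exact hq.one_lt.ne' (Nat.dvd_one.1 (by simpa using hqa))
  set u : ℕ → ℤ := Pi.single a 1 with hu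
  set w : ℕ → ℕ → ℕ → ℤ := fun i _ k => (-1) ^ k * shiftSum u i k with hw
  have hwrel : Rel (n + 1) w := rel_shiftSum _ u
  have hu0 : ∀ i, i ≠ a → u i = 0 := fun i hi => by simp [hu, hi]
  have hw0 : ∀ i j k, i + j + k = n + 1 → a < i ∨ n + 1 - a < j → w i j k = 0 := by
    intro i j k h hij
    rw [hw]
    dsimp only
    rw [shiftSum, Finset.sum_eq_zero, mul_zero]
    intro l hl
    have := Finset.mem_range.1 hl
    rw [hu0 _ (by omega), mul_zero]
  have hwN : (q : ℤ) ∣ w 0 0 (n + 1) := by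
    rw [hw]
    refine Dvd.dvd.mul_left ?_ _
    rw [shiftSum, Finset.sum_eq_single a]
    · exact Dvd.dvd.mul_right (by exact_mod_cast hqa) _
    · intro b _ hb
      rw [hu0 _ (by omega), mul_zero]
    · intro h
      exact absurd (Finset.mem_range.2 (by omega)) h
  have hwa : w a (n + 1 - a) 0 = 1 := by simp [hw, shiftSum_zero, hu]
  -- In degree `n + 1` this box contains the support of `w` except possibly the corner `(0, 0, n +
  -- 1)`. Truncating there leaves a contraction supported at `(0, 0, n)`, with value `-w 0 0 (n +
  -- 1)`, a multiple of `q`.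
  set μ := triple a (n + 1 - a) n with hμ
  set G : (Fin 3 →₀ ℕ) → ℤ := fun e => if e 2 ≤ n then w (e 0) (e 1) (e 2) else 0 with hG
  have hG0 : ∀ e, e.degree = n + 1 → ¬ e ≤ μ → G e = 0 := by
    intro e he hle
    rw [le_iff] at hle
    rw [degree_eq] at he
    simp only [hμ, triple_zero, triple_one, triple_two] at hle
    rw [hG]
    dsimp only
    split_ifs with h
    · exact hw0 _ _ _ he (by omega)
    · rfl
  have hdvd : ∀ e : Fin 3 →₀ ℕ, e.degree = n → (q : ℤ) ∣ ∑ l, G (e + Finsupp.single l 1) := by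
    intro e he
    rw [degree_eq] at he
    rw [eq_triple e, sum_add_single]
    rw [hG]
    simp only [triple_zero, triple_one, triple_two]
    have h := hwrel _ _ _ (congrArg (· + 1) he)
    rw [if_pos (by omega), if_pos (by omega)]
    split_ifs with h2
    · rw [h]; exact dvd_zero _
    · have e0 : e 0 = 0 := by omega
      have e1 : e 1 = 0 := by omega
      have e2 : e 2 + 1 = n + 1 := by omega
      rw [e2, e0, e1] at h
      rw [e0, e1, add_zero, eq_neg_of_add_eq_zero_left h]
      exact (dvd_neg).2 hwN
  have hcon : contract (ofBox μ (n + 1) G) =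
      (q : ℤ) • ofBox μ n (fun e => (∑ l, G (e + Finsupp.single l 1)) / q) := by
    rw [contract_ofBox hG0, zsmul_ofBox]
    exact ofBox_congr fun e he => (Int.mul_ediv_cancel' (hdvd e he)).symm
  refine ⟨_, isHomogeneous_ofBox μ n _, ⟨_, hcon⟩, ?_⟩
  rintro ⟨g, hg⟩
  -- A preimage `g` would make `q g - G` an integral solution in the box. On the edge `k = 0` the
  -- box meets only the point `a`, and the corner value `±C(n+1, a) D(a, n+1-a, 0)` must vanish; so
  -- `q g = G = 1` at that point.
  set D : ℕ → ℕ → ℕ → ℤ := fun i j k =>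
    toBox μ ((q : ℤ) • g - ofBox μ (n + 1) G) (triple i j k) with hD
  have hDrel : Rel (n + 1) D := by
    intro i j k _
    have h0 : contract ((q : ℤ) • g - ofBox μ (n + 1) G) = 0 := by
      rw [map_sub, map_zsmul, hg, hcon, sub_self]
    have := toBox_contract μ ((q : ℤ) • g - ofBox μ (n + 1) G) (triple i j k)
    rw [h0, toBox_zero, sum_add_single] at this
    exact this.symm
  have hDvan : Vanishes (n + 1) a (n + 1 - a) n D := by
    intro i j k _ hijk
    refine toBox_of_not_le _ ?_
    rw [le_iff]
    simp only [hμ, triple_zero, triple_one, triple_two]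
    omega
  have h1 := hDrel.eq_shiftSum (n + 1) 0 0 (by omega)
  rw [hDvan _ _ _ (by omega) (by omega), shiftSum, Finset.sum_eq_single a] at h1
  · have h2 := (mul_eq_zero.1 h1.symm).resolve_left (pow_ne_zero _ (by norm_num))
    have h3 := (mul_eq_zero.1 h2).resolve_left (by exact_mod_cast (Nat.choose_pos ha).ne')
    rw [zero_add, hD] at h3
    dsimp only at h3
    have h4 : (triple a (n + 1 - a) 0) ≤ μ := by
      rw [le_iff]; simp [hμ]
    rw [sub_eq_add_neg, toBox_add, ← neg_one_smul ℤ (ofBox μ _ _), toBox_zsmul, toBox_zsmul,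
      toBox_ofBox, if_pos ⟨rfl, h4, by rw [degree_eq]; simp; omega⟩] at h3
    have h5 : G (triple a (n + 1 - a) 0) = 1 := by simp [hG, hwa]
    rw [h5] at h3
    have h6 : (q : ℤ) ∣ 1 := ⟨toBox μ g (triple a (n + 1 - a) 0), by linear_combination -h3⟩
    exact hq.one_lt.ne' (Nat.dvd_one.1 (by exact_mod_cast h6))
  · intro b hb hba
    have := Finset.mem_range.1 hb
    rw [zero_add, hDvan _ _ _ (by omega) (by omega), mul_zero]
  · intro h
    exact absurd (Finset.mem_range.2 (by omega)) h

end Singh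

/-! ### Associated primes of modules supported at the origin -/

namespace Singh

theorem sub_C_constantCoeff_mem (f : R₀) : f - C (constantCoeff f) ∈ idealXYZ := by
  have h : idealXYZ = Ideal.span (X '' Set.univ) := by
    rw [idealXYZ, Set.image_univ]
    congr 1
    ext x
    simp [Fin.exists_fin_succ, eq_comm]
  rw [h, mem_ideal_span_X_image]
  intro m hm
  by_contra! hcon
  obtain rfl : m = 0 := by
    ext i
    simpa using hcon i (Set.mem_univ i)
  rw [mem_support_iff] at hm
  exact hm (by rw [← constantCoeff_eq, map_sub, constantCoeff_C, sub_self])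

theorem idealXYZ_le_iff (I : Ideal R₀) : idealXYZ ≤ I ↔ ∀ i, X i ∈ I := by
  rw [idealXYZ, Ideal.span_le]
  simp [Set.insert_subset_iff, Fin.forall_fin_succ]

theorem mem_iff_of_idealXYZ_le {I : Ideal R₀} (h : idealXYZ ≤ I) (f : R₀) :
    f ∈ I ↔ C (constantCoeff f) ∈ I := by
  have := h (sub_C_constantCoeff_mem f)
  constructor
  · intro hf
    simpa using I.sub_mem hf this
  · intro hf
    simpa using I.add_mem this hf

theorem idealXYZ_eq_comap : idealXYZ = (⊥ : Ideal ℤ).comap (constantCoeff : R₀ →+* ℤ) := by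
  apply le_antisymm
  · rw [idealXYZ_le_iff]
    intro i
    simp
  · intro f hf
    have h : constantCoeff f = 0 := by simpa using hf
    simpa [h] using sub_C_constantCoeff_mem f

theorem mem_idealXYZ_iff (f : R₀) : f ∈ idealXYZ ↔ constantCoeff f = 0 := by
  simp [idealXYZ_eq_comap]

theorem idealPXYZ_eq_comap (q : ℕ) :
    idealPXYZ q = (Ideal.span {(q : ℤ)}).comap (constantCoeff : R₀ →+* ℤ) := by
  have hle : idealXYZ ≤ idealPXYZ q := Ideal.span_mono (Set.subset_insert _ _)
  apply le_antisymm
  · rw [idealPXYZ, Ideal.span_le]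
    rintro x (rfl | rfl | rfl | rfl) <;> simp
  · intro f hf
    rw [mem_iff_of_idealXYZ_le hle]
    obtain ⟨z, hz⟩ := Ideal.mem_span_singleton'.1 (Ideal.mem_comap.1 hf)
    rw [← hz, map_mul]
    refine Ideal.mul_mem_left _ _ (Ideal.subset_span (Or.inl ?_))
    simp

theorem mem_idealPXYZ_iff (q : ℕ) (f : R₀) : f ∈ idealPXYZ q ↔ (q : ℤ) ∣ constantCoeff f := by
  rw [idealPXYZ_eq_comap, Ideal.mem_comap, Ideal.mem_span_singleton]

theorem idealPXYZ_injective : Function.Injective idealPXYZ := by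
  intro p q h
  have h1 : ∀ a b : ℕ, idealPXYZ a = idealPXYZ b → b ∣ a := by
    intro a b h
    have : (a : R₀) ∈ idealPXYZ b := h ▸ (mem_idealPXYZ_iff a _).2 (by simp)
    rw [mem_idealPXYZ_iff] at this
    simpa [Int.natCast_dvd_natCast] using this
  exact Nat.dvd_antisymm (h1 _ _ h.symm) (h1 _ _ h)

theorem idealPXYZ_ne_idealXYZ {q : ℕ} (hq : q ≠ 0) : idealPXYZ q ≠ idealXYZ := by
  intro h
  have : (q : R₀) ∈ idealXYZ := h ▸ (mem_idealPXYZ_iff q _).2 (by simp)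
  rw [mem_idealXYZ_iff] at this
  exact hq (by simpa using this)

variable {M : Type*} [AddCommGroup M] [Module R₀ M]

theorem smul_eq_zsmul_constantCoeff {x : M} (hx : ∀ i, (X i : R₀) • x = 0) (f : R₀) :
    f • x = constantCoeff f • x := by
  have h : idealXYZ ≤ Submodule.colon ⊥ {x} := by
    rw [idealXYZ_le_iff]
    intro i
    simp [Submodule.mem_colon_singleton, hx]
  have := Submodule.mem_colon_singleton.1 (h (sub_C_constantCoeff_mem f))
  rw [Submodule.mem_bot, sub_smul, sub_eq_zero] at this
  rw [this, ← Int.cast_smul_eq_zsmul R₀]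
  simp

/-- If powers of the variables kill `x` and `x ∉ T`, then `x` has a multiple which is not in `T`
but is multiplied into `T` by the variables. -/
theorem exists_smul_notMem (T : Submodule R₀ M) {x : M}
    (hx : ∀ i, ∃ k, (X i : R₀) ^ k • x = 0) (hxT : x ∉ T) :
    ∃ r : R₀, r • x ∉ T ∧ ∀ i, (X i : R₀) • r • x ∈ T := by
  have step : ∀ s : Finset (Fin 3), ∃ r : R₀, r • x ∉ T ∧ ∀ i ∈ s, (X i : R₀) • r • x ∈ T := by
    intro s
    induction s using Finset.induction_on with
    | empty => exact ⟨1, by simpa using hxT, by simp⟩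
    | insert i s _ ih =>
      obtain ⟨r, hr, hrs⟩ := ih
      obtain ⟨k, hk⟩ := hx i
      classical
      have hex : ∃ k, (X i : R₀) ^ k • r • x ∈ T := ⟨k, by
        rw [smul_comm, hk, smul_zero]; exact T.zero_mem⟩
      obtain ⟨m, hm⟩ : ∃ m, Nat.find hex = m + 1 := Nat.exists_eq_succ_of_ne_zero fun h0 => by
        have := Nat.find_spec hex
        rw [h0] at this
        exact hr (by simpa using this)
      refine ⟨X i ^ m * r, ?_, ?_⟩
      · rw [mul_smul]
        exact Nat.find_min hex (by omega)
      · intro j hj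
        rw [mul_smul]
        rcases Finset.mem_insert.1 hj with rfl | hj
        · rw [← mul_smul, ← pow_succ', ← hm]
          exact Nat.find_spec hex
        · rw [smul_comm]
          exact T.smul_mem _ (hrs j hj)
  obtain ⟨r, h1, h2⟩ := step Finset.univ
  exact ⟨r, h1, fun i => h2 i (Finset.mem_univ i)⟩

/-- A suitable multiple of the torsion element is nonzero and killed by the variables. There `R₀`
acts through the constant coefficient, so the annihilator is read off in `ℤ`. -/
theorem idealPXYZ_mem_associatedPrimes (hM : ∀ (x : M) i, ∃ k, (X i : R₀) ^ k • x = 0) {q : ℕ}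
    (hq : q.Prime) {x : M} (hx : x ≠ 0) (hqx : (q : ℤ) • x = 0) :
    idealPXYZ q ∈ associatedPrimes R₀ M := by
  obtain ⟨r, hr, hr'⟩ := exists_smul_notMem ⊥ (hM x) (by simpa using hx)
  simp only [Submodule.mem_bot] at hr hr'
  have hq' : Prime (q : ℤ) := Nat.prime_iff_prime_int.1 hq
  have : (Ideal.span {(q : ℤ)}).IsPrime := (Ideal.span_singleton_prime hq'.ne_zero).2 hq'
  rw [AssociatedPrimes.mem_iff, IsAssociatedPrime, Submodule.isAssociatedPrime_iff]
  refine ⟨idealPXYZ_eq_comap q ▸ Ideal.comap_isPrime _ _, r • x, ?_⟩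
  have hqr : (q : ℤ) • r • x = 0 := by rw [smul_comm, hqx, smul_zero]
  ext f
  rw [mem_idealPXYZ_iff, Submodule.mem_colon_singleton, Submodule.mem_bot,
    smul_eq_zsmul_constantCoeff hr']
  constructor
  · rintro ⟨z, hz⟩
    rw [hz, mul_comm, mul_smul, hqr, smul_zero]
  · intro h
    by_contra hnd
    obtain ⟨a, b, hab⟩ := ((Nat.prime_iff_prime_int.1 hq).coprime_iff_not_dvd).2 hnd
    apply hr
    rw [← one_smul ℤ (r • x), ← hab, add_smul, mul_smul, mul_smul, hqr, h, smul_zero, smul_zero,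
      add_zero]

theorem idealXYZ_mem_associatedPrimes (hM : ∀ (x : M) i, ∃ k, (X i : R₀) ^ k • x = 0)
    {x : M} (hx : ∀ z : ℤ, z • x = 0 → z = 0) : idealXYZ ∈ associatedPrimes R₀ M := by
  -- The `ℤ`-torsion submodule. Working modulo `T` keeps the multiple of `x` non-torsion; the
  -- integer `w` below then clears the torsion of its products with the variables.
  let T : Submodule R₀ M :=
    { carrier := {y | ∃ z : ℤ, z ≠ 0 ∧ z • y = 0}
      zero_mem' := ⟨1, one_ne_zero, smul_zero _⟩
      add_mem' := by
        rintro a b ⟨z, hz, hza⟩ ⟨w, hw, hwb⟩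
        refine ⟨z * w, mul_ne_zero hz hw, ?_⟩
        rw [smul_add, mul_smul, mul_smul, hwb, smul_zero, add_zero, smul_comm, hza, smul_zero]
      smul_mem' := by
        rintro r a ⟨z, hz, hza⟩
        exact ⟨z, hz, by rw [smul_comm, hza, smul_zero]⟩ }
  have hxT : x ∉ T := fun ⟨z, hz, hzx⟩ => hz (hx z hzx)
  obtain ⟨r, hr, hr'⟩ := exists_smul_notMem T (hM x) hxT
  choose z hz hzr using hr'
  set w : ℤ := ∏ i, z i with hw
  have hw0 : w ≠ 0 := Finset.prod_ne_zero_iff.2 fun i _ => hz i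
  set y : M := w • r • x with hy
  have hXy : ∀ i, (X i : R₀) • y = 0 := by
    intro i
    obtain ⟨c, hc⟩ := Finset.dvd_prod_of_mem z (Finset.mem_univ i)
    rw [hy, smul_comm, hw, hc, mul_comm, mul_smul, hzr, smul_zero]
  have hytor : ∀ c : ℤ, c • y = 0 → c = 0 := by
    intro c hc
    by_contra hc0
    exact hr ⟨c * w, mul_ne_zero hc0 hw0, by rw [mul_smul]; exact hc⟩
  rw [AssociatedPrimes.mem_iff, IsAssociatedPrime, Submodule.isAssociatedPrime_iff]
  refine ⟨idealXYZ_eq_comap ▸ Ideal.comap_isPrime _ _, y, ?_⟩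
  ext f
  rw [mem_idealXYZ_iff, Submodule.mem_colon_singleton, Submodule.mem_bot,
    smul_eq_zsmul_constantCoeff hXy]
  exact ⟨fun h => by rw [h, zero_smul], hytor _⟩

/-- A prime annihilator contains powers of the variables, hence the variables, so it is pulled back
from a prime ideal of `ℤ`. -/
theorem eq_of_mem_associatedPrimes (hM : ∀ (x : M) i, ∃ k, (X i : R₀) ^ k • x = 0)
    {P : Ideal R₀} (hP : P ∈ associatedPrimes R₀ M) :
    P = idealXYZ ∨ ∃ q : ℕ, q.Prime ∧ (∃ x : M, x ≠ 0 ∧ (q : ℤ) • x = 0) ∧ P = idealPXYZ q := by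
  rw [AssociatedPrimes.mem_iff, IsAssociatedPrime, Submodule.isAssociatedPrime_iff] at hP
  obtain ⟨hprime, x, hx⟩ := hP
  have hmem : ∀ f, f ∈ P ↔ f • x = 0 := by
    intro f; rw [hx, Submodule.mem_colon_singleton, Submodule.mem_bot]
  have hle : idealXYZ ≤ P := by
    rw [idealXYZ_le_iff]
    intro i
    obtain ⟨k, hk⟩ := hM x i
    exact hprime.mem_of_pow_mem k ((hmem _).2 hk)
  have hJ : (P.comap (C : ℤ →+* R₀)).IsPrime := Ideal.comap_isPrime _ _
  have hPJ : P = (P.comap (C : ℤ →+* R₀)).comap (constantCoeff : R₀ →+* ℤ) := by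
    ext f
    rw [mem_iff_of_idealXYZ_le hle]; rfl
  obtain ⟨z, hz⟩ : ∃ z : ℤ, P.comap (C : ℤ →+* R₀) = Ideal.span {z} :=
    (IsPrincipalIdealRing.principal _).principal
  have hz' : P.comap (C : ℤ →+* R₀) = Ideal.span {(z.natAbs : ℤ)} := by
    rw [hz, Ideal.span_singleton_eq_span_singleton]
    exact Int.associated_natAbs z
  rcases eq_or_ne z 0 with rfl | hz0
  · left
    rw [hPJ, hz, idealXYZ_eq_comap]
    simp
  · right
    rw [hz'] at hJ hPJ
    have hp : z.natAbs.Prime := Nat.prime_iff_prime_int.2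
      ((Ideal.span_singleton_prime (by simpa using hz0)).1 hJ)
    refine ⟨z.natAbs, hp, ⟨x, ?_, ?_⟩, by rw [hPJ, idealPXYZ_eq_comap]⟩
    · rintro rfl
      exact hprime.ne_top ((Ideal.eq_top_iff_one _).2 ((hmem 1).2 (smul_zero _)))
    · rw [← Int.cast_smul_eq_zsmul R₀, ← hmem, hPJ, Ideal.mem_comap, Ideal.mem_span_singleton]
      simp

theorem associatedPrimes_eq (hM : ∀ (x : M) i, ∃ k, (X i : R₀) ^ k • x = 0)
    {x : M} (hx : ∀ z : ℤ, z • x = 0 → z = 0) :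
    associatedPrimes R₀ M = {idealXYZ} ∪ {I | ∃ q ∈ {q : ℕ | q.Prime ∧
      ∃ x : M, x ≠ 0 ∧ (q : ℤ) • x = 0}, I = idealPXYZ q} := by
  ext P
  constructor
  · intro hP
    rcases eq_of_mem_associatedPrimes hM hP with h | ⟨q, hq, hx, h⟩
    · exact Or.inl h
    · exact Or.inr ⟨q, ⟨hq, hx⟩, h⟩
  · rintro (rfl | ⟨q, ⟨hq, y, hy, hqy⟩, rfl⟩)
    · exact idealXYZ_mem_associatedPrimes hM hx
    · exact idealPXYZ_mem_associatedPrimes hM hq hy hqy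

end Singh

theorem span_prime_mem_associatedPrimes_int_iff {M : Type*} [AddCommGroup M] {q : ℕ}
    (hq : q.Prime) :
    Ideal.span {(q : ℤ)} ∈ associatedPrimes ℤ M ↔ ∃ x : M, x ≠ 0 ∧ (q : ℤ) • x = 0 := by
  have hq' : Prime (q : ℤ) := Nat.prime_iff_prime_int.1 hq
  rw [AssociatedPrimes.mem_iff, IsAssociatedPrime, Submodule.isAssociatedPrime_iff]
  constructor
  · rintro ⟨hp, x, hx⟩
    have hmem : ∀ z : ℤ, z ∈ Ideal.span {(q : ℤ)} ↔ z • x = 0 := by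
      intro z; rw [hx, Submodule.mem_colon_singleton, Submodule.mem_bot]
    refine ⟨x, ?_, (hmem _).1 (Ideal.mem_span_singleton_self _)⟩
    rintro rfl
    exact hp.ne_top ((Ideal.eq_top_iff_one _).2 ((hmem 1).2 (smul_zero _)))
  · rintro ⟨x, hx, hqx⟩
    refine ⟨(Ideal.span_singleton_prime hq'.ne_zero).2 hq', x, ?_⟩
    ext z
    rw [Ideal.mem_span_singleton, Submodule.mem_colon_singleton, Submodule.mem_bot]
    constructor
    · rintro ⟨w, rfl⟩
      rw [mul_comm, mul_smul, hqx, smul_zero]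
    · intro h
      by_contra hnd
      obtain ⟨a, b, hab⟩ := (hq'.coprime_iff_not_dvd).2 hnd
      apply hx
      rw [← one_smul ℤ x, ← hab, add_smul, mul_smul, mul_smul, hqx, h, smul_zero, smul_zero,
        add_zero]

/-! ### Prime factors of binomial coefficients -/

theorem binomialPrimes_subset (n : ℕ) : binomialPrimes n ⊆ Set.Iic n := by
  rintro p ⟨hp, i, hi, hd⟩
  by_contra h
  have h1 : p ∣ n.factorial := by
    rw [← Nat.choose_mul_factorial_mul_factorial hi]
    exact (hd.mul_right _).mul_right _
  exact h ((hp.dvd_factorial).1 h1)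

theorem mem_binomialPrimes_of_dvd {p n : ℕ} (hp : p.Prime) (hn : n ≠ 0) (h : p ∣ n) :
    p ∈ binomialPrimes n := ⟨hp, 1, Nat.one_le_iff_ne_zero.2 hn, by simpa using h⟩

/-- Since `p` divides the inner coefficients `C(p^k, i+1)`, Pascal's rule passes divisibility of
`C(p^k - 1, i+1)` down to `C(p^k - 1, i)`, and finally to `C(p^k - 1, 0) = 1`. -/
theorem notMem_binomialPrimes {p : ℕ} (hp : p.Prime) (k : ℕ) :
    p ∉ binomialPrimes (p ^ k - 1) := by
  rintro ⟨-, i, hi, hd⟩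
  have : Fact p.Prime := ⟨hp⟩
  have hpos : 0 < p ^ k := pow_pos hp.pos k
  revert hi hd
  induction i with
  | zero => intro _ hd; exact hp.one_lt.ne' (Nat.dvd_one.1 (by simpa using hd))
  | succ i ih =>
    intro hi hd
    refine ih (by omega) ?_
    have h1 : p ∣ (p ^ k).choose (i + 1) := hp.dvd_choose_pow (by omega) (by omega)
    have h2 := Nat.choose_succ_succ (p ^ k - 1) i
    rw [Nat.succ_eq_add_one, Nat.sub_add_cancel hpos] at h2
    rw [h2] at h1
    exact (Nat.dvd_add_left hd).1 h1

theorem exists_le_ncard_binomialPrimes (b : ℕ) :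
    ∃ n, 1 ≤ n ∧ b ≤ (binomialPrimes n).ncard := by
  obtain ⟨s, hs, hcard⟩ := Nat.infinite_setOfPred_prime.exists_subset_card_eq b
  have hne : ∏ p ∈ s, p ≠ 0 := Finset.prod_ne_zero_iff.2 fun p hp => (hs hp).ne_zero
  refine ⟨∏ p ∈ s, p, Nat.one_le_iff_ne_zero.2 hne, ?_⟩
  rw [← hcard, ← Set.ncard_coe_finset]
  refine Set.ncard_le_ncard ?_ ((Set.finite_Iic _).subset (binomialPrimes_subset _))
  intro p hp
  exact mem_binomialPrimes_of_dvd (hs hp) hne (Finset.dvd_prod_of_mem (fun p => p) hp)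

/-! ### The top Čech cohomology module of three elements -/

namespace CechLocal

variable {A : Type} [CommRing A] (f : Fin 3 → A)

/-- The localization of `A` at the product of the three elements `f i`. -/
abbrev TopLoc : Type := Localization.Away (∏ i ∈ (Finset.univ : Finset (Fin 3)), f i)

theorem eq_univ_of_card_three (s : {s : Finset (Fin 3) // s.card = 3}) :
    s = ⟨Finset.univ, rfl⟩ :=
  Subtype.ext (Finset.eq_univ_of_card _ (by simpa using s.2))

theorem res_self {s : Finset (Fin 3)} (h : s ⊆ s) (x : Localization.Away (∏ i ∈ s, f i)) :
    res f h x = x := by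
  have : res f h = AlgHom.id A _ :=
    IsLocalization.algHom_ext (Submonoid.powers (∏ i ∈ s, f i)) (Subsingleton.elim _ _)
  rw [this]; rfl

/-- The `3`-cochain given by an element of the localization. -/
def topCochain : TopLoc f →ₗ[A] Cochain f 3 :=
  LinearMap.pi fun s => (res f (t := Finset.univ) (s := s.1)
    (by rw [eq_univ_of_card_three s])).toLinearMap

theorem topCochain_apply (y : TopLoc f) : topCochain f y ⟨Finset.univ, rfl⟩ = y :=
  res_self f (Finset.Subset.refl _) y

theorem eq_topCochain (x : Cochain f 3) : x = topCochain f (x ⟨Finset.univ, rfl⟩) := by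
  funext s
  obtain rfl := eq_univ_of_card_three s
  rw [topCochain_apply]

theorem mem_ker_d_three (x : Cochain f 3) : x ∈ LinearMap.ker (d f 3) := by
  rw [LinearMap.mem_ker]
  funext s
  have := s.1.card_le_univ
  rw [s.2, Fintype.card_fin] at this
  omega

/-- The class in `H^3` of an element of the localization. -/
def topClass : TopLoc f →ₗ[A] H f 3 :=
  ((coboundaries f 3).submoduleOf (LinearMap.ker (d f 3))).mkQ ∘ₗ
    (topCochain f).codRestrict _ fun _ => mem_ker_d_three f _

theorem pow_prod_mul_res (j : Fin 3) (k : ℕ) {a : A}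
    {y : Localization.Away (∏ i ∈ Finset.univ.erase j, f i)}
    (h : algebraMap A _ ((∏ i ∈ Finset.univ.erase j, f i) ^ k) * y = algebraMap A _ a) :
    algebraMap A (TopLoc f) ((∏ i, f i) ^ k) * res f (Finset.erase_subset j Finset.univ) y =
      algebraMap A _ (f j ^ k * a) := by
  have h1 := congrArg (res f (Finset.erase_subset j Finset.univ)) h
  rw [map_mul, AlgHom.commutes, AlgHom.commutes] at h1
  have h2 : (∏ i, f i) ^ k = f j ^ k * (∏ i ∈ Finset.univ.erase j, f i) ^ k := by
    rw [← Finset.mul_prod_erase _ _ (Finset.mem_univ j), mul_pow]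
  rw [congrArg (algebraMap A (TopLoc f)) h2, map_mul, mul_assoc, h1, ← map_mul]

/-- A coboundary is a signed sum of three fractions, each lacking one `f j` in its denominator; over
a common denominator the missing factor appears as `f j ^ k`. The signs are absorbed into `a`. -/
theorem mem_coboundaries_three (x : Cochain f 3) :
    x ∈ coboundaries f 3 ↔ ∃ (k : ℕ) (a : Fin 3 → A),
      algebraMap A (TopLoc f) ((∏ i, f i) ^ k) * x ⟨Finset.univ, rfl⟩ =
        algebraMap A _ (∑ j, f j ^ k * a j) := by
  constructor
  · rintro ⟨c, rfl⟩
    have hsurj : ∀ j : Fin 3, ∃ (k : ℕ) (a : A),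
        algebraMap A _ ((∏ i ∈ Finset.univ.erase j, f i) ^ k) *
          c ⟨Finset.univ.erase j, by simp⟩ = algebraMap A _ a := by
      intro j
      obtain ⟨k, a, h⟩ := IsLocalization.Away.surj (∏ i ∈ Finset.univ.erase j, f i)
        (c ⟨Finset.univ.erase j, by simp⟩)
      exact ⟨k, a, by rw [← h, map_pow, mul_comm]⟩
    choose k a hka using hsurj
    set K := ∑ j, k j with hK
    have hle : ∀ j, k j ≤ K := fun j => Finset.single_le_sum (by simp) (Finset.mem_univ j)
    refine ⟨K, fun j => (-1) ^ ((Finset.univ : Finset (Fin 3)).filter (· < j)).card *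
      ((∏ i ∈ Finset.univ.erase j, f i) ^ (K - k j) * a j), ?_⟩
    rw [d_apply, Finset.mul_sum, map_sum]
    refine Eq.trans (Finset.sum_congr rfl fun j _ => ?_) (Finset.sum_coe_sort Finset.univ
      fun j => algebraMap A (TopLoc f) (f j ^ K * ((-1) ^ (Finset.univ.filter (· < j)).card *
        ((∏ i ∈ Finset.univ.erase j, f i) ^ (K - k j) * a j))))
    rw [mul_smul_comm, pow_prod_mul_res f j.1 K
      (a := (∏ i ∈ Finset.univ.erase j.1, f i) ^ (K - k j) * a j)]
    · rw [Algebra.smul_def, ← map_mul, mul_left_comm]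
    · rw [map_mul, ← hka, ← mul_assoc, ← map_mul, ← pow_add, Nat.sub_add_cancel (hle j)]
  · rintro ⟨k, a, h⟩
    let b : Finset (Fin 3) → A := fun t => ∑ j, if t = Finset.univ.erase j then
      (-1) ^ ((Finset.univ : Finset (Fin 3)).filter (· < j)).card * a j else 0
    have hb : ∀ j, b (Finset.univ.erase j) =
        (-1) ^ ((Finset.univ : Finset (Fin 3)).filter (· < j)).card * a j := by
      intro j
      refine (Finset.sum_eq_single j ?_ (by simp)).trans (if_pos rfl)
      intro i _ hij
      refine if_neg fun h => hij ?_
      exact ((Finset.erase_inj _ (Finset.mem_univ j)).1 h).symm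
    refine ⟨fun t => Localization.mk (b t.1) ⟨(∏ i ∈ t.1, f i) ^ k, k, rfl⟩, ?_⟩
    have hunit : IsUnit (algebraMap A (TopLoc f) ((∏ i, f i) ^ k)) := by
      rw [map_pow]
      exact (IsLocalization.Away.algebraMap_isUnit _).pow k
    funext s
    obtain rfl := eq_univ_of_card_three s
    refine hunit.mul_left_cancel ?_
    rw [h, d_apply, Finset.mul_sum, map_sum]
    refine Eq.trans (Finset.sum_congr rfl fun j _ => ?_) (Finset.sum_coe_sort Finset.univ
      fun j => algebraMap A (TopLoc f) (f j ^ k * a j))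
    rw [mul_smul_comm, pow_prod_mul_res f j.1 k (a := b (Finset.univ.erase j.1))]
    · rw [hb, Algebra.smul_def, ← map_mul, mul_left_comm, ← mul_assoc ((-1 : A) ^ _), ← mul_pow]
      simp
    · rw [Localization.mk_eq_mk', mul_comm]
      exact IsLocalization.mk'_spec _ _ _

theorem topClass_eq_zero_iff (y : TopLoc f) :
    topClass f y = 0 ↔ ∃ (k : ℕ) (a : Fin 3 → A),
      algebraMap A (TopLoc f) ((∏ i, f i) ^ k) * y = algebraMap A _ (∑ j, f j ^ k * a j) := by
  rw [topClass, LinearMap.comp_apply, Submodule.mkQ_apply, Submodule.Quotient.mk_eq_zero,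
    Submodule.submoduleOf, Submodule.mem_comap]
  refine (mem_coboundaries_three f (topCochain f y)).trans ?_
  rw [topCochain_apply]

theorem mkQ_eq_topClass (x : LinearMap.ker (d f 3)) :
    ((coboundaries f 3).submoduleOf (LinearMap.ker (d f 3))).mkQ x =
      topClass f (x.1 ⟨Finset.univ, rfl⟩) := by
  rw [topClass, LinearMap.comp_apply]
  congr 1
  exact Subtype.ext (eq_topCochain f x.1)

theorem mem_gradedPiece_three_iff {K : Type} [CommRing K] [Algebra K A] (𝒜 : ℕ → Submodule K A)
    (n : ℤ) (z : H f 3) : z ∈ gradedPiece 𝒜 f 3 n ↔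
      ∃ y ∈ locDegree 𝒜 (Submonoid.powers (∏ i ∈ Finset.univ, f i)) n, topClass f y = z := by
  have h : ∀ x : LinearMap.ker (d f 3), x.1 ∈ cochainDegree 𝒜 f 3 n ↔
      x.1 ⟨Finset.univ, rfl⟩ ∈ locDegree 𝒜 (Submonoid.powers (∏ i ∈ Finset.univ, f i)) n := by
    intro x
    rw [cochainDegree, Submodule.mem_pi]
    constructor
    · exact fun hx => hx ⟨Finset.univ, rfl⟩ (Set.mem_univ _)
    · intro hx s _
      obtain rfl := eq_univ_of_card_three s
      exact hx
  rw [gradedPiece, Submodule.mem_map]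
  constructor
  · rintro ⟨x, hx, hxz⟩
    exact ⟨x.1 ⟨Finset.univ, rfl⟩, (h x).1 hx, (mkQ_eq_topClass f x).symm.trans hxz⟩
  · rintro ⟨y, hy, hyz⟩
    have h1 := topCochain_apply f y
    have h2 := (h ⟨topCochain f y, mem_ker_d_three f _⟩).2 (by
      change topCochain f y ⟨Finset.univ, rfl⟩ ∈ _
      rwa [h1])
    refine ⟨⟨topCochain f y, mem_ker_d_three f _⟩, h2, ?_⟩
    refine (mkQ_eq_topClass f _).trans ?_
    change topClass f (topCochain f y ⟨Finset.univ, rfl⟩) = z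
    rw [h1, hyz]

end CechLocal

/-! ### The local cohomology of Singh's ring through inverse polynomials -/

namespace Singh

open CechLocal

/-- The constant exponent vector. -/
def constExp (m : ℕ) : Fin 3 →₀ ℕ := Finsupp.equivFunOnFinite.symm fun _ => m

@[simp] theorem constExp_apply (m : ℕ) (i : Fin 3) : constExp m i = m := rfl

theorem le_constExp_iff (e : Fin 3 →₀ ℕ) (m : ℕ) : e ≤ constExp m ↔ ∀ i, e i ≤ m := Iff.rfl

theorem exists_support_le_constExp (f : R) : ∃ m, ∀ e ∈ f.support, e ≤ constExp m := by
  refine ⟨∑ e ∈ f.support, e.degree, fun e he => (le_constExp_iff _ _).2 fun i => ?_⟩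
  exact (Finsupp.le_degree i e).trans
    (Finset.single_le_sum (f := fun e : Fin 3 →₀ ℕ => e.degree) (fun _ _ => Nat.zero_le _) he)

variable {A : Type} [CommRing A] [Algebra R₀ A] (π : R →ₐ[R₀] A)

/-- The images of `U`, `V`, `W`. -/
def imageVars (i : Fin 3) : A := π (X i)

/-- The inverses of `U`, `V`, `W` in the localization. -/
def invVar (i : Fin 3) : TopLoc (imageVars π) :=
  algebraMap A (TopLoc (imageVars π)) (∏ j ∈ Finset.univ.erase i, imageVars π j) *
    IsLocalization.Away.invSelf (∏ j ∈ Finset.univ, imageVars π j)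

theorem algebraMap_uvw_mul_invVar (i : Fin 3) :
    algebraMap A (TopLoc (imageVars π)) (imageVars π i) * invVar π i = 1 := by
  rw [invVar, ← mul_assoc, ← map_mul, Finset.mul_prod_erase _ _ (Finset.mem_univ i)]
  exact IsLocalization.Away.mul_invSelf _

/-- The map `R → A_{UVW}` sending `U^a V^b W^c` to `U^(-a-1) V^(-b-1) W^(-c-1)`. -/
def inversePoly : R →ₗ[R₀] TopLoc (imageVars π) :=
  LinearMap.mulLeft R₀ (∏ i, invVar π i) ∘ₗ (aeval (invVar π)).toLinearMap

theorem inversePoly_monomial (e : Fin 3 →₀ ℕ) (c : R₀) :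
    inversePoly π (monomial e c) = c • ∏ i, invVar π i ^ (e i + 1) := by
  rw [inversePoly, LinearMap.comp_apply, AlgHom.toLinearMap_apply, LinearMap.mulLeft_apply,
    aeval_monomial, Finsupp.prod_fintype _ _ (by simp), mul_left_comm, ← Finset.prod_mul_distrib,
    ← Algebra.smul_def]
  simp only [pow_succ']

theorem map_monomial_eq (e : Fin 3 →₀ ℕ) (c : R₀) :
    π (monomial e c) = c • ∏ i, imageVars π i ^ e i := by
  have h : (monomial e c : R) = c • ∏ i, X i ^ e i := by
    rw [monomial_eq, Finsupp.prod_fintype _ _ (by simp), smul_eq_C_mul]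
  rw [h, map_smul, map_prod]
  simp only [map_pow]
  rfl

theorem pow_mul_inversePoly_monomial {m : ℕ} {e : Fin 3 →₀ ℕ} (he : e ≤ constExp m) (c : R₀) :
    algebraMap A (TopLoc (imageVars π)) ((∏ i, imageVars π i) ^ (m + 1)) *
        inversePoly π (monomial e c) =
      algebraMap A (TopLoc (imageVars π)) (π (monomial (constExp m - e) c)) := by
  rw [inversePoly_monomial π, map_monomial_eq, mul_smul_comm]
  rw [← IsScalarTower.coe_toAlgHom' R₀ A (TopLoc (imageVars π)), map_smul, map_pow,
    map_prod, map_prod,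
    ← Finset.prod_pow, ← Finset.prod_mul_distrib]
  congr 1
  refine Finset.prod_congr rfl fun i _ => ?_
  have h1 : m + 1 = (constExp m - e) i + (e i + 1) := by
    have := he i
    simp at this ⊢
    omega
  rw [h1, pow_add _ ((constExp m - e) i), mul_assoc, ← mul_pow, map_pow]
  rw [IsScalarTower.coe_toAlgHom', algebraMap_uvw_mul_invVar π, one_pow, mul_one]

/-- The polynomial with all exponents `e` replaced by `E - e`. -/
def reversePoly (E : Fin 3 →₀ ℕ) (f : R) : R := ∑ e ∈ f.support, monomial (E - e) (coeff e f)

theorem pow_mul_inversePoly {m : ℕ} {f : R} (hf : ∀ e ∈ f.support, e ≤ constExp m) :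
    algebraMap A (TopLoc (imageVars π)) ((∏ i, imageVars π i) ^ (m + 1)) * inversePoly π f =
      algebraMap A (TopLoc (imageVars π)) (π (reversePoly (constExp m) f)) := by
  conv_lhs => rw [f.as_sum]
  rw [map_sum, Finset.mul_sum, reversePoly, map_sum, map_sum]
  exact Finset.sum_congr rfl fun e he => pow_mul_inversePoly_monomial π (hf e he) _

theorem coeff_reversePoly {E : Fin 3 →₀ ℕ} {f : R} (hf : ∀ e ∈ f.support, e ≤ E) {e : Fin 3 →₀ ℕ}
    (he : e ≤ E) : coeff (E - e) (reversePoly E f) = coeff e f := by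
  rw [reversePoly, coeff_sum]
  have h : ∀ d ∈ f.support, coeff (E - e) (monomial (E - d) (coeff d f)) =
      if e = d then coeff d f else 0 := by
    intro d hd
    rw [coeff_monomial]
    refine if_congr ⟨fun h => ?_, fun h => by rw [h]⟩ rfl rfl
    rw [← tsub_tsub_cancel_of_le (hf d hd), h, tsub_tsub_cancel_of_le he]
  rw [Finset.sum_congr rfl h, Finset.sum_ite_eq]
  split_ifs with h
  · rfl
  · exact (notMem_support_iff.1 h).symm

/-- Complementing exponents turns multiplication by `F` into `contract`, so the reversal of `G` is
the preimage. The terms with `X j ^ (m + 1)` are invisible at exponents `E - e`, all at most `m`. -/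
theorem mem_range_contract_of_reversePoly_eq {m : ℕ} {f : R}
    (hf : ∀ e ∈ f.support, e ≤ constExp m) (b : Fin 3 → R) (G : R)
    (h : reversePoly (constExp m) f = ∑ j, X j ^ (m + 1) * b j + F * G) :
    f ∈ LinearMap.range contract := by
  set E := constExp m with hE
  set g : R := ∑ e ∈ Finset.Iic E, monomial e (coeff (E - e) G) with hg
  have hgc : ∀ e, coeff e g = if e ≤ E then coeff (E - e) G else 0 := by
    intro e
    simp [hg, coeff_sum, coeff_monomial]
  refine ⟨g, ?_⟩
  ext e : 1
  rw [coeff_contract]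
  by_cases he : e ≤ E
  · have h0 : coeff (E - e) (∑ j, X j ^ (m + 1) * b j) = 0 := by
      rw [coeff_sum]
      refine Finset.sum_eq_zero fun j _ => ?_
      rw [X_pow_eq_monomial, coeff_monomial_mul', if_neg]
      intro hle
      have := hle j
      simp [hE] at this
      omega
    rw [← coeff_reversePoly hf he, h, coeff_add, h0, zero_add]
    have hF : F = ∑ i, C (X i) * X i := by rw [F, Fin.sum_univ_three]
    rw [hF, Finset.sum_mul, coeff_sum]
    refine Finset.sum_congr rfl fun i _ => ?_
    rw [mul_assoc, coeff_C_mul, coeff_X_mul', hgc]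
    have : i ∈ (E - e).support ↔ e + Finsupp.single i 1 ≤ E := by
      rw [Finsupp.mem_support_iff, ← le_tsub_iff_left he, Finsupp.single_le_iff]
      omega
    simp only [this, tsub_tsub]
  · rw [Finset.sum_eq_zero]
    · refine (notMem_support_iff.1 fun h' => he (hf e h')).symm
    · intro i _
      rw [hgc, if_neg fun h' => he ((by simp : e ≤ e + Finsupp.single i 1).trans h'), mul_zero]

theorem prod_X_pow_mul_reversePoly {m : ℕ} {f : R} (hf : ∀ e ∈ f.support, e ≤ constExp m) (l : ℕ) :
    (∏ i, X i) ^ l * reversePoly (constExp m) f = reversePoly (constExp (m + l)) f := by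
  have h : ((∏ i, X i) ^ l : R) = monomial (constExp l) 1 := by
    rw [monomial_eq, C_1, one_mul, Finsupp.prod_fintype _ _ (by simp), ← Finset.prod_pow]
    rfl
  rw [h, reversePoly, reversePoly, Finset.mul_sum]
  refine Finset.sum_congr rfl fun e he => ?_
  rw [monomial_mul, one_mul]
  congr 2
  ext i
  have := hf e he i
  simp at this ⊢
  omega

/-- The class in `H^3` of an inverse polynomial. -/
def inverseClass : R →ₗ[R₀] H (imageVars π) 3 :=
  (topClass (imageVars π)).restrictScalars R₀ ∘ₗ inversePoly π

theorem inverseClass_apply (f : R) : inverseClass π f = topClass (imageVars π) (inversePoly π f) :=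
  rfl

theorem topClass_eq_zero_of_pow_mul_eq {y : TopLoc (imageVars π)} (k : ℕ) (j : Fin 3) (a : A)
    (h : algebraMap A (TopLoc (imageVars π)) ((∏ i, imageVars π i) ^ k) * y =
      algebraMap A (TopLoc (imageVars π)) (imageVars π j ^ k * a)) :
    topClass (imageVars π) y = 0 := by
  rw [topClass_eq_zero_iff]
  refine ⟨k, Pi.single j a, ?_⟩
  rw [h, Finset.sum_eq_single j]
  · simp
  · intro i _ hi
    simp [hi]
  · simp

theorem mem_range_contract_of_inverseClass_eq_zero (hπ : Function.Surjective π)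
    (hF : RingHom.ker π = Ideal.span {F}) {f : R} (h : inverseClass π f = 0) :
    f ∈ LinearMap.range contract := by
  rw [inverseClass_apply, topClass_eq_zero_iff] at h
  obtain ⟨k, a, h⟩ := h
  obtain ⟨m, hm⟩ := exists_support_le_constExp f
  have hcomp : ∀ j : Fin 3, (∏ i, imageVars π i : A) =
      imageVars π j * ∏ i ∈ Finset.univ.erase j, imageVars π i :=
    fun j => (Finset.mul_prod_erase _ _ (Finset.mem_univ j)).symm
  -- Needed twice: to clear the denominators of `f`, then to absorb the power of `UVW` by which
  -- equality in the localization becomes equality in `A`.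
  have hup : ∀ (l K : ℕ) (a : Fin 3 → A), ∃ a' : Fin 3 → A,
      (∏ i, imageVars π i) ^ l * ∑ j, imageVars π j ^ K * a j =
        ∑ j, imageVars π j ^ (K + l) * a' j := by
    intro l K a
    refine ⟨fun j => (∏ i ∈ Finset.univ.erase j, imageVars π i) ^ l * a j, ?_⟩
    rw [Finset.mul_sum]
    refine Finset.sum_congr rfl fun j _ => ?_
    rw [hcomp j]
    ring
  obtain ⟨a', ha'⟩ := hup (m + 1) k a
  have hm' : ∀ e ∈ f.support, e ≤ constExp (m + k) := by
    intro e he i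
    have := hm e he i
    simp at this ⊢
    omega
  have h1 : algebraMap A (TopLoc (imageVars π)) (π (reversePoly (constExp (m + k)) f)) =
      algebraMap A (TopLoc (imageVars π)) (∑ j, imageVars π j ^ (k + (m + 1)) * a' j) := by
    rw [← pow_mul_inversePoly π hm', ← ha', map_mul _ (_ ^ (m + 1)), ← h, ← mul_assoc, ← map_mul,
      ← pow_add, add_right_comm, add_comm (m + 1)]
  obtain ⟨⟨_, l, rfl⟩, hl⟩ := (IsLocalization.eq_iff_exists
    (Submonoid.powers (∏ i ∈ (Finset.univ : Finset (Fin 3)), imageVars π i))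
    (TopLoc (imageVars π))).1 h1
  obtain ⟨a'', ha''⟩ := hup l _ a'
  choose b hb using fun j => hπ (a'' j)
  have hpX : ∀ i, π (X i) = imageVars π i := fun _ => rfl
  have h2 : π (reversePoly (constExp (m + k + l)) f) =
      π (∑ j, X j ^ (m + k + l + 1) * b j) := by
    rw [← prod_X_pow_mul_reversePoly hm', map_mul, map_pow, map_prod, map_sum]
    simp only [map_mul, map_pow, hpX, hb]
    refine hl.trans (ha''.trans (Finset.sum_congr rfl fun j _ => ?_))
    rw [show k + (m + 1) + l = m + k + l + 1 by omega]
  rw [← sub_eq_zero, ← map_sub, ← RingHom.mem_ker, hF, Ideal.mem_span_singleton'] at h2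
  obtain ⟨G, hG⟩ := h2
  refine mem_range_contract_of_reversePoly_eq (m := m + k + l) (fun e he i => ?_) b G ?_
  · have := hm e he i
    simp at this ⊢
    omega
  · rw [mul_comm F, hG]; ring

/-- Multiplying an inverse monomial by `F` gives `0` in the localization. The terms omitted by
`contract`, those with `e i = 0`, have no `i`-th variable left in the denominator and are
coboundaries. -/
theorem inverseClass_contract_monomial (hF0 : π F = 0) (e : Fin 3 →₀ ℕ) (c : R₀) :
    inverseClass π (contract (monomial e c)) = 0 := by
  have hterm : ∀ i, topClass (imageVars π) ((X i : R₀) •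
      (algebraMap A (TopLoc (imageVars π)) (imageVars π i) * inversePoly π (monomial e c))) =
      inverseClass π (if e i = 0 then 0 else monomial (e - Finsupp.single i 1) (X i * c)) := by
    intro i
    split_ifs with h
    · rw [map_zero]
      obtain ⟨m, hm⟩ : ∃ m, e ≤ constExp m :=
        ⟨e.degree, fun j => Finsupp.le_degree j e⟩
      refine topClass_eq_zero_of_pow_mul_eq π (m + 1) i
        (π (monomial (constExp m - e - Finsupp.single i m) (X i * c))) ?_
      have hX : ∀ d : Fin 3 →₀ ℕ, (monomial d (X i * c) : R) = (X i : R₀) • monomial d c := by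
        intro d; simp [smul_monomial]
      rw [mul_smul_comm, mul_left_comm, pow_mul_inversePoly_monomial π hm, ← map_mul,
        ← algebraMap_smul A (X i : R₀), Algebra.smul_def, ← map_mul]
      congr 1
      have hpX : π (X i) = imageVars π i := rfl
      have hC : algebraMap R₀ A (X i) = π (C (X i)) := (π.commutes _).symm
      rw [hC, ← hpX, ← map_mul, ← map_mul, ← map_pow, ← map_mul]
      congr 1
      have hXm : ∀ (d : Fin 3 →₀ ℕ) (c : R₀),
          (X i : R) * monomial d c = monomial (Finsupp.single i 1 + d) c := by
        intro d c
        rw [X, monomial_mul, one_mul]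
      rw [X_pow_eq_monomial, monomial_mul, one_mul, hXm, C_mul_monomial]
      refine congrArg (fun d => monomial d (X i * c)) ?_
      ext j
      by_cases hij : j = i
      · subst hij; simp [h]; omega
      · simp [hij]
    · rw [inverseClass_apply, inversePoly_monomial π, inversePoly_monomial π, mul_smul_comm, smul_smul]
      congr 2
      rw [← Finset.mul_prod_erase _ (fun j => invVar π j ^ (e j + 1)) (Finset.mem_univ i),
        ← Finset.mul_prod_erase _ (fun j => invVar π j ^ ((e - Finsupp.single i 1 : Fin 3 →₀ ℕ) j + 1))
          (Finset.mem_univ i), pow_succ', ← mul_assoc, ← mul_assoc,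
        algebraMap_uvw_mul_invVar π, one_mul]
      congr 1
      · congr 1
        simp; omega
      · refine Finset.prod_congr rfl fun j hj => ?_
        simp [(Finset.ne_of_mem_erase hj)]
  rw [contract_monomial, map_sum, ← Finset.sum_congr rfl fun i _ => hterm i, ← map_sum]
  have h0 : ∑ i, (X i : R₀) • (algebraMap A (TopLoc (imageVars π)) (imageVars π i) *
      inversePoly π (monomial e c)) = algebraMap A (TopLoc (imageVars π)) (π F) * inversePoly π (monomial e c) := by
    have hF : π F = ∑ i, (X i : R₀) • imageVars π i := by
      simp only [F, Fin.sum_univ_three, map_add, ← smul_eq_C_mul, map_smul]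
      rfl
    rw [hF, map_sum, Finset.sum_mul]
    refine Finset.sum_congr rfl fun i _ => ?_
    rw [← IsScalarTower.coe_toAlgHom' R₀ A (TopLoc (imageVars π)), map_smul, smul_mul_assoc]
  rw [h0, hF0, map_zero, zero_mul, map_zero]

theorem inverseClass_eq_zero_iff (hπ : Function.Surjective π)
    (hF : RingHom.ker π = Ideal.span {F}) (f : R) :
    inverseClass π f = 0 ↔ f ∈ LinearMap.range contract := by
  refine ⟨mem_range_contract_of_inverseClass_eq_zero π hπ hF, ?_⟩
  have hF0 : π F = 0 := by
    rw [← RingHom.mem_ker, hF]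
    exact Ideal.mem_span_singleton_self _
  rintro ⟨g, rfl⟩
  rw [g.as_sum, map_sum, map_sum]
  exact Finset.sum_eq_zero fun e _ => inverseClass_contract_monomial π hF0 e _

/-! ### Graded components of `H^3` as images of forms -/

variable {A : Type} [CommRing A] [Algebra R₀ A] (π : R →ₐ[R₀] A)

/-- The grading of a quotient of `R` by the images of the forms. -/
abbrev imageGrading (n : ℕ) : Submodule R₀ A :=
  (homogeneousSubmodule (Fin 3) R₀ n).map π.toLinearMap

/-- The degree of a denominator is unambiguous: setting `X = Y = Z = 0` kills `F`, and `(UVW)^k`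
stays nonzero in `ℤ[U,V,W]`. -/
theorem degree_of_prod_pow_mem (hF : RingHom.ker π = Ideal.span {F}) {j k : ℕ}
    (h : (∏ i, imageVars π i) ^ k ∈ imageGrading π j) : j = 3 * k := by
  obtain ⟨q, hq, hqk⟩ := h
  have hq' : q.IsHomogeneous j := hq
  have h1 : π (q - (∏ i, X i) ^ k) = 0 := by
    rw [map_sub, map_pow, map_prod, sub_eq_zero]
    exact hqk
  rw [← RingHom.mem_ker, hF, Ideal.mem_span_singleton'] at h1
  obtain ⟨b, hb⟩ := h1
  have h2 := congrArg (MvPolynomial.map (constantCoeff : R₀ →+* ℤ)) hb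
  have hF0 : MvPolynomial.map (constantCoeff : R₀ →+* ℤ) F = 0 := by simp [F]
  rw [map_mul, hF0, mul_zero, map_sub, map_pow, map_prod] at h2
  simp only [map_X] at h2
  have hX : (∏ i : Fin 3, (X i : MvPolynomial (Fin 3) ℤ)).IsHomogeneous 3 := by
    have := IsHomogeneous.prod Finset.univ (fun i : Fin 3 => (X i : MvPolynomial (Fin 3) ℤ))
      (fun _ => 1) fun i _ => isHomogeneous_X ℤ i
    simpa using this
  have h3 := hq'.map (constantCoeff : R₀ →+* ℤ)
  rw [sub_eq_zero.1 h2.symm] at h3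
  have h0 : (∏ i : Fin 3, (X i : MvPolynomial (Fin 3) ℤ)) ^ k ≠ 0 :=
    pow_ne_zero _ (Finset.prod_ne_zero_iff.2 fun i _ => X_ne_zero i)
  exact h3.inj_right (hX.pow k) h0

theorem isUnit_pow_prod (k : ℕ) :
    IsUnit (algebraMap A (TopLoc (imageVars π)) ((∏ i, imageVars π i) ^ k)) := by
  rw [map_pow]
  exact (IsLocalization.Away.algebraMap_isUnit _).pow k

theorem degree_constExp_sub {m : ℕ} {e : Fin 3 →₀ ℕ} (he : e ≤ constExp m) :
    (constExp m - e).degree + e.degree = 3 * m := by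
  rw [← map_add, tsub_add_cancel_of_le he, degree_eq]
  simp only [constExp_apply]
  ring

theorem isHomogeneous_coeff_degree {n : ℕ} {f : R} (hf : f.IsHomogeneous n) {e : Fin 3 →₀ ℕ}
    (he : e ∈ f.support) : e.degree = n := by
  have := hf (mem_support_iff.1 he)
  rwa [Pi.one_def, ← Finsupp.degree_eq_weight_one] at this

theorem gradedPiece_eq_map (hF : RingHom.ker π = Ideal.span {F}) (n : ℕ) :
    gradedPiece (imageGrading π) (imageVars π) 3 (-((n + 3 : ℕ) : ℤ)) =
      (homogeneousSubmodule (Fin 3) R₀ n).map (inverseClass π) := by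
  apply le_antisymm
  · intro z hz
    rw [mem_gradedPiece_three_iff] at hz
    obtain ⟨y, hy, rfl⟩ := hz
    change y ∈ ((homogeneousSubmodule (Fin 3) R₀ n).map (inverseClass π)).comap
      ((topClass (imageVars π)).restrictScalars R₀)
    revert y
    change locDegree _ _ _ ≤ _
    rw [locDegree, Submodule.span_le]
    rintro _ ⟨i, j, _, ⟨S, k, hk⟩, ⟨p, hp, rfl⟩, hS, hij, rfl⟩
    change (∏ i, imageVars π i) ^ k = S at hk
    subst hk
    obtain rfl := degree_of_prod_pow_mem π hF hS
    obtain ⟨m, rfl⟩ : ∃ m, k = m + 1 := Nat.exists_eq_succ_of_ne_zero (by rintro rfl; omega)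
    have hp' : p.IsHomogeneous i := hp
    have hi : i + n = 3 * m := by push_cast at hij; omega
    set s : Submonoid.powers (∏ i ∈ (Finset.univ : Finset (Fin 3)), imageVars π i) :=
      ⟨(∏ i, imageVars π i) ^ (m + 1), m + 1, rfl⟩ with hs
    set t : TopLoc (imageVars π) := Localization.mk 1 s with ht
    have hst : algebraMap A (TopLoc (imageVars π)) ((∏ i, imageVars π i) ^ (m + 1)) * t = 1 := by
      rw [ht, Localization.mk_eq_mk', mul_comm]
      exact (IsLocalization.mk'_spec _ _ _).trans (map_one _)
    have hmk : Localization.mk (π.toLinearMap p) s =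
        algebraMap A (TopLoc (imageVars π)) (π p) * t := by
      rw [ht, Localization.mk_eq_mk', ← IsLocalization.mk'_eq_mul_mk'_one]
      rfl
    rw [SetLike.mem_coe, hmk, p.as_sum, map_sum, map_sum, Finset.sum_mul]
    refine Submodule.sum_mem _ fun e he => ?_
    have hde := isHomogeneous_coeff_degree hp' he
    rw [Submodule.mem_comap, LinearMap.restrictScalars_apply]
    -- If all exponents are at most `m`, the fraction over `(UVW)^(m+1)` is an inverse monomial;
    -- otherwise one variable cancels from the denominator and the class is zero.
    by_cases hem : e ≤ constExp m
    · have h1 : algebraMap A (TopLoc (imageVars π)) (π (monomial e (coeff e p))) * t =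
          inversePoly π (monomial (constExp m - e) (coeff e p)) := by
        refine (isUnit_pow_prod π (m + 1)).mul_left_cancel ?_
        rw [pow_mul_inversePoly_monomial π tsub_le_self, tsub_tsub_cancel_of_le hem, mul_left_comm,
          hst, mul_one]
      rw [h1]
      refine ⟨_, isHomogeneous_monomial _ ?_, rfl⟩
      have := degree_constExp_sub hem
      omega
    · have : ∃ l, m < e l := by
        by_contra! hcon
        exact hem ((le_constExp_iff _ _).2 hcon)
      obtain ⟨l, hl⟩ := this
      rw [topClass_eq_zero_of_pow_mul_eq π (m + 1) l
        (π (monomial (e - Finsupp.single l (m + 1)) (coeff e p)))]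
      · exact Submodule.zero_mem _
      · rw [mul_left_comm, hst, mul_one, imageVars, ← map_pow, ← map_mul]
        congr 2
        rw [X_pow_eq_monomial, monomial_mul, one_mul, add_tsub_cancel_of_le]
        rw [Finsupp.single_le_iff]
        omega
  · rintro _ ⟨f, hf, rfl⟩
    have hf' : f.IsHomogeneous n := hf
    rw [f.as_sum, map_sum]
    refine Submodule.sum_mem _ fun e he => ?_
    have hde := isHomogeneous_coeff_degree hf' he
    have hen : e ≤ constExp n := fun i => (Finsupp.le_degree i e).trans hde.le
    rw [mem_gradedPiece_three_iff]
    refine ⟨inversePoly π (monomial e (coeff e f)), ?_, rfl⟩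
    -- Over the denominator `(UVW)^(n+1)`, the numerator has exponent `constExp n - e`, of degree
    -- `3n - n`.
    refine Submodule.subset_span ⟨2 * n, 3 * (n + 1),
      π (monomial (constExp n - e) (coeff e f)), ⟨(∏ i, imageVars π i) ^ (n + 1), n + 1, rfl⟩,
      ⟨_, isHomogeneous_monomial _ ?_, rfl⟩, ⟨(∏ i, X i) ^ (n + 1), ?_, ?_⟩, ?_, ?_⟩
    · have := degree_constExp_sub hen
      omega
    · have := IsHomogeneous.prod Finset.univ (fun i : Fin 3 => (X i : R)) (fun _ => 1)
        fun i _ => isHomogeneous_X R₀ i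
      simpa using this.pow (n + 1)
    · rw [AlgHom.toLinearMap_apply, map_pow, map_prod]
      rfl
    · push_cast; ring
    · refine (isUnit_pow_prod π (n + 1)).mul_left_cancel ?_
      rw [pow_mul_inversePoly_monomial π hen, Localization.mk_eq_mk', mul_comm]
      exact (IsLocalization.mk'_spec _ _ _).symm

/-! ### Torsion in the graded components -/

section Component

variable {π} {n : ℕ} {T : Submodule R₀ (H (imageVars π) 3)}

theorem exists_X_pow_smul_eq_zero (hπ : Function.Surjective π) (hF : RingHom.ker π = Ideal.span {F})
    (hT : T = (homogeneousSubmodule (Fin 3) R₀ n).map (inverseClass π))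
    (x : T) (i : Fin 3) : ∃ k, (X i : R₀) ^ k • x = 0 := by
  obtain ⟨x, hx⟩ := x
  have hx' := hx
  rw [hT] at hx'
  obtain ⟨f, hf, rfl⟩ := hx'
  refine ⟨n + 1, Subtype.ext ?_⟩
  change (X i : R₀) ^ (n + 1) • inverseClass π f = 0
  rw [← map_smul, inverseClass_eq_zero_iff π hπ hF]
  exact X_pow_smul_mem_range_contract hf i

/-- The range of `contract` has all its coefficients in `(X, Y, Z)`, so no nonzero integer multiple
of a pure monomial lies in it. -/
theorem exists_torsionFree (hπ : Function.Surjective π) (hF : RingHom.ker π = Ideal.span {F})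
    (hT : T = (homogeneousSubmodule (Fin 3) R₀ n).map (inverseClass π)) :
    ∃ x : T, ∀ z : ℤ, z • x = 0 → z = 0 := by
  have hm : inverseClass π (monomial (Finsupp.single 0 n) 1) ∈ T := by
    rw [hT]
    exact ⟨_, isHomogeneous_monomial _ (by simp), rfl⟩
  refine ⟨⟨_, hm⟩, fun z hz => ?_⟩
  have h1 : z • inverseClass π (monomial (Finsupp.single 0 n) 1) = 0 := congrArg Subtype.val hz
  rw [← map_zsmul, inverseClass_eq_zero_iff π hπ hF] at h1
  obtain ⟨g, hg⟩ := h1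
  have h2 := constantCoeff_coeff_contract g (Finsupp.single 0 n)
  have h3 : (z • monomial (Finsupp.single 0 n) 1 : R) =
      C (C z) * monomial (Finsupp.single 0 n) 1 := by
    rw [zsmul_eq_mul]; simp
  rw [hg, h3, coeff_C_mul, coeff_monomial, if_pos rfl, mul_one, constantCoeff_C] at h2
  exact h2

theorem exists_prime_torsion_iff (hπ : Function.Surjective π) (hF : RingHom.ker π = Ideal.span {F})
    (hT : T = (homogeneousSubmodule (Fin 3) R₀ n).map (inverseClass π))
    {q : ℕ} (hq : q.Prime) :
    (∃ x : T, x ≠ 0 ∧ (q : ℤ) • x = 0) ↔ q ∈ binomialPrimes (n + 1) := by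
  constructor
  · rintro ⟨⟨x, hx⟩, hx0, hqx⟩
    have hx' := hx
    rw [hT] at hx'
    obtain ⟨f, hf, rfl⟩ := hx'
    have h1 : (q : ℤ) • inverseClass π f = 0 := congrArg Subtype.val hqx
    rw [← map_zsmul, inverseClass_eq_zero_iff π hπ hF] at h1
    by_contra hcon
    refine hx0 (Subtype.ext ((inverseClass_eq_zero_iff π hπ hF f).2 ?_))
    exact mem_range_contract_of_prime_smul hq (fun i hi hd => hcon ⟨hq, i, hi, hd⟩) hf h1
  · rintro ⟨-, a, ha, hqa⟩
    obtain ⟨f, hf, hqf, hfn⟩ := exists_prime_smul_mem_range_contract hq ha hqa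
    have hm : inverseClass π f ∈ T := by
      rw [hT]
      exact ⟨f, hf, rfl⟩
    refine ⟨⟨_, hm⟩, fun h => hfn ?_, Subtype.ext ?_⟩
    · exact (inverseClass_eq_zero_iff π hπ hF f).1 (congrArg Subtype.val h)
    · change (q : ℤ) • inverseClass π f = 0
      rw [← map_zsmul, inverseClass_eq_zero_iff π hπ hF]
      exact hqf

theorem associatedPrimes_component (hπ : Function.Surjective π) (hF : RingHom.ker π = Ideal.span {F})
    (hT : T = (homogeneousSubmodule (Fin 3) R₀ n).map (inverseClass π)) :
    associatedPrimes R₀ T = {idealXYZ} ∪ {I | ∃ q ∈ binomialPrimes (n + 1), I = idealPXYZ q} := by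
  obtain ⟨x, hx⟩ := exists_torsionFree hπ hF hT
  rw [associatedPrimes_eq (exists_X_pow_smul_eq_zero hπ hF hT) hx]
  congr 1
  ext I
  refine exists_congr fun q => and_congr_left fun _ => ⟨fun h => ?_, fun h => ⟨h.1, ?_⟩⟩
  · exact (exists_prime_torsion_iff hπ hF hT h.1).1 h.2
  · exact (exists_prime_torsion_iff hπ hF hT h.1).2 h

end Component

/-! ### Transfer to Singh's ring -/

theorem associatedPrimes_gradedPiece {u : Fin 3 → A} {𝒜 : ℕ → Submodule R₀ A}
    (hu : u = imageVars π)
    (h𝒜 : ∀ m x, x ∈ 𝒜 m ↔ ∃ p : R, p.IsHomogeneous m ∧ π p = x)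
    (hπ : Function.Surjective π)
    (hF : RingHom.ker π = Ideal.span {F}) (n : ℕ) :
    associatedPrimes R₀ (gradedPiece 𝒜 u 3 (-((n + 3 : ℕ) : ℤ))) =
      {idealXYZ} ∪ {I | ∃ q ∈ binomialPrimes (n + 1), I = idealPXYZ q} := by
  obtain rfl : 𝒜 = imageGrading π := funext fun m => Submodule.ext fun x => h𝒜 m x
  subst hu
  exact associatedPrimes_component hπ hF (gradedPiece_eq_map π hF n)

theorem span_prime_mem_associatedPrimes_gradedPiece {u : Fin 3 → A} {𝒜 : ℕ → Submodule R₀ A}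
    (hu : u = imageVars π)
    (h𝒜 : ∀ m x, x ∈ 𝒜 m ↔ ∃ p : R, p.IsHomogeneous m ∧ π p = x)
    (hπ : Function.Surjective π)
    (hF : RingHom.ker π = Ideal.span {F}) (n : ℕ) {q : ℕ} (hq : q.Prime) :
    Ideal.span {(q : ℤ)} ∈ associatedPrimes ℤ (gradedPiece 𝒜 u 3 (-((n + 3 : ℕ) : ℤ))) ↔
      q ∈ binomialPrimes (n + 1) := by
  obtain rfl : 𝒜 = imageGrading π := funext fun m => Submodule.ext fun x => h𝒜 m x
  subst hu
  rw [span_prime_mem_associatedPrimes_int_iff hq]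
  exact exists_prime_torsion_iff hπ hF (gradedPiece_eq_map π hF n) hq

/-- The projection `R → R'`. -/
abbrev proj : R →ₐ[R₀] R' := Ideal.Quotient.mkₐ R₀ (Ideal.span {F})

theorem uvw_eq : uvw = imageVars proj := rfl

theorem mem_grading_iff (m : ℕ) (x : R') :
    x ∈ grading m ↔ ∃ p : R, p.IsHomogeneous m ∧ proj p = x := Iff.rfl

theorem proj_surjective : Function.Surjective proj := Ideal.Quotient.mkₐ_surjective _ _

theorem ker_proj : RingHom.ker proj = Ideal.span {F} := by
  ext x
  rw [RingHom.mem_ker]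
  exact Ideal.Quotient.eq_zero_iff_mem

theorem associatedPrimes_H3 {d : ℕ} (hd : 3 ≤ d) :
    associatedPrimes R₀ (H3 (-(d : ℤ))) =
      {idealXYZ} ∪ {I | ∃ q ∈ binomialPrimes (d - 2), I = idealPXYZ q} := by
  obtain ⟨n, rfl⟩ := Nat.exists_eq_add_of_le' hd
  exact associatedPrimes_gradedPiece proj uvw_eq mem_grading_iff proj_surjective ker_proj n

theorem span_prime_mem_associatedPrimes_H3 {d : ℕ} (hd : 3 ≤ d) {q : ℕ} (hq : q.Prime) :
    Ideal.span {(q : ℤ)} ∈ associatedPrimes ℤ (H3 (-(d : ℤ))) ↔ q ∈ binomialPrimes (d - 2) := by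
  obtain ⟨n, rfl⟩ := Nat.exists_eq_add_of_le' hd
  exact span_prime_mem_associatedPrimes_gradedPiece proj uvw_eq mem_grading_iff proj_surjective
    ker_proj n hq

theorem idealPXYZ_mem_associatedPrimes_H3 {d : ℕ} (hd : 3 ≤ d) {q : ℕ} (hq : q.Prime) :
    idealPXYZ q ∈ associatedPrimes R₀ (H3 (-(d : ℤ))) ↔ q ∈ binomialPrimes (d - 2) := by
  rw [associatedPrimes_H3 hd]
  constructor
  · rintro (h | ⟨p, hp, h⟩)
    · exact absurd h (idealPXYZ_ne_idealXYZ hq.ne_zero)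
    · rwa [idealPXYZ_injective h]
  · exact fun h => Or.inr ⟨q, h, rfl⟩

theorem finite_associatedPrimes_H3 {d : ℕ} (hd : 3 ≤ d) :
    (associatedPrimes R₀ (H3 (-(d : ℤ)))).Finite := by
  rw [associatedPrimes_H3 hd]
  refine (Set.finite_singleton _).union ?_
  refine (((Set.finite_Iic _).subset (binomialPrimes_subset (d - 2))).image idealPXYZ).subset ?_
  rintro _ ⟨q, hq, rfl⟩
  exact ⟨q, hq, rfl⟩

theorem ncard_binomialPrimes_le {d : ℕ} (hd : 3 ≤ d) :
    (binomialPrimes (d - 2)).ncard ≤ (associatedPrimes R₀ (H3 (-(d : ℤ)))).ncard := by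
  rw [← Set.ncard_image_of_injective _ idealPXYZ_injective]
  refine Set.ncard_le_ncard ?_ (finite_associatedPrimes_H3 hd)
  rintro _ ⟨q, hq, rfl⟩
  exact (idealPXYZ_mem_associatedPrimes_H3 hd hq.1).2 hq

end Singh

end

theorem theorem2p17 :
    (∀ d : ℕ, 3 ≤ d → ∀ p : ℕ, p.Prime →
      (Ideal.span {(p : ℤ)} ∈ associatedPrimes ℤ (Singh.H3 (-(d : ℤ))) ↔
        p ∈ binomialPrimes (d - 2))) ∧
    (∀ d : ℕ, 3 ≤ d →
      associatedPrimes Singh.R₀ (Singh.H3 (-(d : ℤ))) =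
        {Singh.idealXYZ} ∪ {I | ∃ q ∈ binomialPrimes (d - 2), I = Singh.idealPXYZ q}) ∧
    ((∀ j : ℕ, 3 ≤ j → (associatedPrimes Singh.R₀ (Singh.H3 (-(j : ℤ)))).Finite) ∧
      ¬ BddAbove {m : ℕ | ∃ j : ℕ, 3 ≤ j ∧
        m = (associatedPrimes Singh.R₀ (Singh.H3 (-(j : ℤ)))).ncard}) ∧
    (∀ p : ℕ, p.Prime →
      {j : ℕ | 3 ≤ j ∧
        Singh.idealPXYZ p ∈ associatedPrimes Singh.R₀ (Singh.H3 (-(j : ℤ)))}.Infinite ∧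
      {j : ℕ | 3 ≤ j ∧
        Singh.idealPXYZ p ∉ associatedPrimes Singh.R₀ (Singh.H3 (-(j : ℤ)))}.Infinite) ∧
    ¬ AsymptoticallyIncreasing
      (fun n : ℤ => associatedPrimes Singh.R₀ (Singh.H3 n)) := by
  refine ⟨fun d hd p hp => Singh.span_prime_mem_associatedPrimes_H3 hd hp,
    fun d hd => Singh.associatedPrimes_H3 hd,
    ⟨fun j hj => Singh.finite_associatedPrimes_H3 hj, ?_⟩, fun p hp => ⟨?_, ?_⟩, ?_⟩
  · rintro ⟨b, hb⟩
    obtain ⟨n, hn, hbn⟩ := exists_le_ncard_binomialPrimes (b + 1)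
    have h1 := hb ⟨n + 2, by omega, rfl⟩
    have h2 := Singh.ncard_binomialPrimes_le (d := n + 2) (by omega)
    rw [Nat.add_sub_cancel] at h2
    omega
  -- Here `j - 2` is a positive multiple of `p`, and `C(j - 2, 1) = j - 2`.
  · refine Set.infinite_of_forall_exists_gt fun a => ⟨p * (a + 1) + 2, ⟨?_, ?_⟩, ?_⟩
    · have := Nat.le_mul_of_pos_left (a + 1) hp.pos
      omega
    · have := Nat.le_mul_of_pos_left (a + 1) hp.pos
      rw [Singh.idealPXYZ_mem_associatedPrimes_H3 (by omega) hp, Nat.add_sub_cancel]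
      exact mem_binomialPrimes_of_dvd hp (by omega) (dvd_mul_right _ _)
    · have := Nat.le_mul_of_pos_left (a + 1) hp.pos
      omega
  -- Here `j - 2 = p^(a+2) - 1`, none of whose binomial coefficients is divisible by `p`.
  · refine Set.infinite_of_forall_exists_gt fun a => ⟨p ^ (a + 2) + 1, ⟨?_, ?_⟩, ?_⟩
    · have := Nat.lt_pow_self hp.one_lt (n := a + 2)
      omega
    · have := Nat.lt_pow_self hp.one_lt (n := a + 2)
      rw [Singh.idealPXYZ_mem_associatedPrimes_H3 (by omega) hp]
      exact notMem_binomialPrimes hp (a + 2)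
    · have := Nat.lt_pow_self hp.one_lt (n := a + 2)
      omega
  · rintro ⟨n₀, h⟩
    -- Take `d = 2^k` with `k = |n₀| + 2`: `d - 2` is even and positive, so `(2, X, Y, Z)` occurs in
    -- degree `-d`, while `d - 1 = 2^k - 1` excludes it in degree `-d - 1`.
    have hk := Nat.lt_pow_self one_lt_two (n := n₀.natAbs + 2)
    have h1 := h (-((2 ^ (n₀.natAbs + 2) : ℕ) : ℤ)) (by omega)
    have h2 : -((2 ^ (n₀.natAbs + 2) : ℕ) : ℤ) - 1 = -((2 ^ (n₀.natAbs + 2) + 1 : ℕ) : ℤ) := by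
      push_cast; ring
    dsimp only at h1
    rw [h2] at h1
    have h4 : 4 ≤ 2 ^ (n₀.natAbs + 2) := by
      rw [pow_add]
      have := Nat.one_le_two_pow (n := n₀.natAbs)
      omega
    have h3 := h1 ((Singh.idealPXYZ_mem_associatedPrimes_H3 (by omega) Nat.prime_two).2
      (mem_binomialPrimes_of_dvd Nat.prime_two (by omega)
        (Nat.dvd_sub (dvd_pow_self 2 (by omega)) dvd_rfl)))
    rw [Singh.idealPXYZ_mem_associatedPrimes_H3 (by omega) Nat.prime_two] at h3
    exact notMem_binomialPrimes Nat.prime_two _ h3
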